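/- Let $N_r\ge 1$ and let $\mathcal S_4=\{e^{j(\pi/4+\pi i/2)}: i=0,1,2,3\}$ be the QPSK constellation. Let $\mathcal Q_2:\mathbb C\to\mathcal S_4$ be a 2-bit phase quantizer, i.e. $\mathcal Q_2(x)\in\arg\min_{z\in\mathcal S_4}|z-x|$ for every $x$ (ties broken arbitrarily). Let the transmit symbol $s$ be uniform on $\mathcal S_4$, let the channel $\mathbf h=(h_1,\dots,h_{N_r})$ and the noise $\mathbf n$ both be $\mathcal{CN}(\mathbf 0,\mathbf I_{N_r})$ (i.i.d. Rayleigh fading), and let $s,\mathbf h,\mathbf n$ be mutually independent. For SNR $\rho>0$ let $\mathbf y=\sqrt\rho\,\mathbf h s+\mathbf n$, let $\mathbf r=\mathcal Q_2(\mathbf y)$ (applied entrywise), and let $\hat s=\mathcal Q_2(\mathbf h^{\mathrm H}\mathbf r)$ be the symbol detected by maximum ratio combining with perfect channel knowledge. Let $\mathscr P(\rho)=\Pr(\hat s\ne s)$ be the average symbol error probability (over symbol, channel and noise). Write $h_i=|h_i|e^{j\theta_i}$, $\mathcal Q_2(h_i)=e^{j\phi_i}$, and set $$Z_i=\sqrt2\,|h_i|\cos\!\left(\theta_i-\phi_i+\tfrac{\pi}{4}\right),\qquad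 T=\frac1{\sqrt{N_r}}\sum_{i=1}^{N_r}Z_i,\qquad U=T^2 .$$ Then $Z_1,\dots,Z_{N_r}$ are i.i.d. half-normal with density $\sqrt{2/\pi}\,e^{-z^2/2}$ on $z\ge0$, and, with $Q(x)=\frac1{\sqrt{2\pi}}\int_x^\infty e^{-t^2/2}\,dt$, for every $\rho>0$ $$\mathscr P(\rho)=2\,\mathbb E\big[Q(\sqrt{\rho U})\big]-\Big(\mathbb E\big[Q(\sqrt{\rho U})\big]\Big)^2 .$$ Moreover, $\mathscr P(\rho)=(G_c\,\rho)^{-G_d}+o(\rho^{-G_d})$ as $\rho\to\infty$, with diversity gain and coding gain $$G_d=\frac{N_r}{2},\qquad G_c=\left(\frac{1}{N_r!}\,2^{N_r}\,\pi^{-\frac{N_r+1}{2}}\,N_r^{\frac{N_r}{2}}\,\Gamma\!\left(\frac{N_r+1}{2}\right)\right)^{-\frac{2}{N_r}} .$$ -/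

import Mathlib

open MeasureTheory ProbabilityTheory Filter Asymptotics

noncomputable section

namespace QuantizedSIMO

/-- The `M`-PSK constellation `{exp(j(π/4 + 2πi/M)) : i = 0, …, M-1}`. -/
def pskConstellation (M : ℕ) : Set ℂ :=
  {z | ∃ i : ℕ, i < M ∧
    z = Complex.exp (((Real.pi / 4 + 2 * Real.pi / M * i : ℝ) : ℂ) * Complex.I)}

/-- `Q` is an `n`-bit phase quantization function: `Q x` is, for every `x`, a point of the
`2^n`-PSK constellation at minimum distance from `x` (ties are broken arbitrarily). -/
def IsPhaseQuantizer (n : ℕ) (Q : ℂ → ℂ) : Prop :=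
  ∀ x : ℂ, Q x ∈ pskConstellation (2 ^ n) ∧
    ∀ z ∈ pskConstellation (2 ^ n), ‖Q x - x‖ ≤ ‖z - x‖

/-- The circularly symmetric complex Gaussian law `CN(0, 1)`: real and imaginary parts are
independent real Gaussians with mean `0` and variance `1/2`. -/
def complexGaussian : Measure ℂ :=
  ((gaussianReal 0 (1 / 2)).prod (gaussianReal 0 (1 / 2))).map
    (fun p : ℝ × ℝ => (p.1 : ℂ) + (p.2 : ℂ) * Complex.I)

/-- The law `CN(0, I_N)` on `ℂ^N`. -/
def complexGaussianVec (N : ℕ) : Measure (Fin N → ℂ) :=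
  Measure.pi fun _ => complexGaussian

/-- Transmit symbol `s`, channel vector `h` and noise vector `w` of a SIMO link with `N` receive
antennas under i.i.d. Rayleigh fading: `s` is uniform on the `M`-PSK constellation, `h` and `w`
are `CN(0, I_N)`, and the three are mutually independent. -/
structure IsRayleighSIMO {Ω : Type*} [MeasurableSpace Ω] (P : Measure Ω) (M N : ℕ)
    (s : Ω → ℂ) (h w : Ω → Fin N → ℂ) : Prop where
  symbol_law : HasLaw s (uniformOn (pskConstellation M)) P
  channel_law : HasLaw h (complexGaussianVec N) P
  noise_law : HasLaw w (complexGaussianVec N) P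
  indep_channel_noise : IndepFun h w P
  indep_symbol : IndepFun s (fun ω => (h ω, w ω)) P

/-- The received vector before quantization, `y = √ρ h s + w`. -/
def received {N : ℕ} (ρ : ℝ) (s : ℂ) (h w : Fin N → ℂ) : Fin N → ℂ :=
  fun i => (Real.sqrt ρ : ℂ) * h i * s + w i

/-- The symbol detected by maximum ratio combining of the quantized received vector,
`ŝ = Qdet(hᴴ Qrec(y))`; `Qrec` quantizes each antenna output, `Qdet` is the minimum-distance
detector. -/
def mrcDetect {N : ℕ} (Qrec Qdet : ℂ → ℂ) (ρ : ℝ) (s : ℂ) (h w : Fin N → ℂ) : ℂ :=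
  Qdet (∑ i, starRingEnd ℂ (h i) * Qrec (received ρ s h w i))

/-- The average symbol error probability `P(ŝ ≠ s)` at transmit SNR `ρ`, the probability being
over symbol, channel and noise. -/
def averageSEP {Ω : Type*} [MeasurableSpace Ω] (P : Measure Ω) {N : ℕ} (Qrec Qdet : ℂ → ℂ)
    (s : Ω → ℂ) (h w : Ω → Fin N → ℂ) (ρ : ℝ) : ℝ :=
  P.real {ω | mrcDetect Qrec Qdet ρ (s ω) (h ω) (w ω) ≠ s ω}

/-- The Gaussian `Q`-function. -/
def gaussQ (x : ℝ) : ℝ :=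
  1 / Real.sqrt (2 * Real.pi) * ∫ t in Set.Ioi x, Real.exp (-t ^ 2 / 2)

/-- For a channel gain `g = |g| e^{jθ}` with `Q g = e^{jφ}`, the statistic
`Z = √2 |g| cos(θ - φ + π/4)`. -/
def statZ (Q : ℂ → ℂ) (g : ℂ) : ℝ :=
  Real.sqrt 2 * ‖g‖ * Real.cos (Complex.arg g - Complex.arg (Q g) + Real.pi / 4)

/-- `T = N^{-1/2} ∑ᵢ Zᵢ`. -/
def statT {N : ℕ} (Q : ℂ → ℂ) (h : Fin N → ℂ) : ℝ :=
  1 / Real.sqrt N * ∑ i, statZ Q (h i)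

/-- `U = T²`. -/
def statU {N : ℕ} (Q : ℂ → ℂ) (h : Fin N → ℂ) : ℝ :=
  statT Q h ^ 2

/-- The half-normal law, with density `√(2/π) e^{-z²/2}` on `z ≥ 0`. -/
def halfNormal : Measure ℝ :=
  volume.withDensity fun z =>
    ENNReal.ofReal (if 0 ≤ z then Real.sqrt (2 / Real.pi) * Real.exp (-z ^ 2 / 2) else 0)

/-- The error probability `p(ρ)` has diversity gain `Gd` and coding gain `Gc`:
`p(ρ) = (Gc ρ)^{-Gd} + o(ρ^{-Gd})` as `ρ → ∞`, with `Gd, Gc > 0`. -/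
def HasDiversityCodingGain (p : ℝ → ℝ) (Gd Gc : ℝ) : Prop :=
  0 < Gd ∧ 0 < Gc ∧
    (fun ρ : ℝ => p ρ - (Gc * ρ) ^ (-Gd)) =o[atTop] fun ρ : ℝ => ρ ^ (-Gd)

end QuantizedSIMO

end

noncomputable section

namespace QuantizedSIMO

/-! ### Invariances of centred Gaussian pairs -/

/-! Fix the symbol `s` and put `g = h s`; since `s` has modulus one, rotation invariance gives `g`
the law of `h`. Let `ε`, `δ` be the signs of the real and imaginary parts of an antenna output. As
`conj h = s * conj g`, that antenna adds the two numbers `ε * Re g` and `δ * Im g` to the combiner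
coordinates aligned with `s`, in an order decided by `a`, `b` and whether `ε = δ` (`combiner_term`).
Almost surely, detection is correct exactly when both sums over the antennas are positive.

The data-dependent order does no harm. Negating channel and noise together flips an output sign but
keeps the aligned gain, so each sign is a fair coin independent of its gain, and the exchanged pair
is still i.i.d. (`measurePreserving_signedSwap`, `measurePreserving_branchGains`). The same
principle gives the law of `Z`, which is `√2 |Re h|` or `√2 |Im h|` according to the signs
(`statZ_eq`, `hasLaw_statZ`).

An orthogonal change of variables along the output writes an aligned gain in law as `(√ρ z + e) /
√(2(1 + ρ))`, with `z` half-normal and `e` an independent standard normal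
(`measurePreserving_alignedGainLaw`). Conditioning on the `z`'s, a sum fails to be positive with
probability `E = 𝔼[Q(√ρ T)]`, so the error probability is `1 - (1 - E)² = 2E - E²`. These `z`'s are
not the `Zᵢ` themselves; agreement in law suffices.

At high SNR, `E` is the probability that `√ρ T` lies below an independent standard normal. The
distribution function of `∑ Zᵢ` near `0` is the Gaussian density at the origin times the volume of
an ℓ¹ ball, of order `r ^ N` (`sumAbsCDF_le`, `le_sumAbsCDF`). Dominated convergence then gives the
limit of `ρ^{N/2} E` as a half-line Gaussian moment, hence the Gamma factor, while `E²` is of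
smaller order. -/

lemma measurePreserving_neg_gaussianReal (v : NNReal) :
    MeasurePreserving (fun x : ℝ => -x) (gaussianReal 0 v) (gaussianReal 0 v) :=
  ⟨measurable_neg, by rw [gaussianReal_map_neg, neg_zero]⟩

/-- Rotation by the argument of `a + bj`, followed by a sign change of the second coordinate. The
reflection is preferred to the rotation later because it is its own inverse. -/
lemma measurePreserving_reflection (v : NNReal) {a b : ℝ} (hab : a ^ 2 + b ^ 2 = 1) :
    MeasurePreserving (fun p : ℝ × ℝ => (a * p.1 + b * p.2, b * p.1 - a * p.2))
      ((gaussianReal 0 v).prod (gaussianReal 0 v))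
      ((gaussianReal 0 v).prod (gaussianReal 0 v)) := by
  have hz : ‖(⟨a, b⟩ : ℂ)‖ = 1 := by
    rw [Complex.norm_eq_sqrt_sq_add_sq]; simp [hab]
  have hz0 : (⟨a, b⟩ : ℂ) ≠ 0 := by
    intro h; rw [h] at hz; simp at hz
  have hc := Complex.cos_arg hz0
  have hs := Complex.sin_arg (⟨a, b⟩ : ℂ)
  rw [hz, div_one] at hc hs
  have hrot : MeasurePreserving (ContinuousLinearMap.rotation (E := ℝ) (Complex.arg ⟨a, b⟩))
      ((gaussianReal 0 v).prod (gaussianReal 0 v))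
      ((gaussianReal 0 v).prod (gaussianReal 0 v)) :=
    ⟨by fun_prop, IsGaussian.map_rotation_eq_self (by simp) _⟩
  have hneg := (MeasurePreserving.id (gaussianReal 0 v)).prod (measurePreserving_neg_gaussianReal v)
  convert hneg.comp hrot using 1
  funext p
  simp only [Function.comp, ContinuousLinearMap.rotation_apply, hc, hs, Prod.map, id, smul_eq_mul]
  ext <;> simp; ring

lemma measurePreserving_rotation (v : NNReal) {a b : ℝ} (hab : a ^ 2 + b ^ 2 = 1) :
    MeasurePreserving (fun p : ℝ × ℝ => (a * p.1 - b * p.2, b * p.1 + a * p.2))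
      ((gaussianReal 0 v).prod (gaussianReal 0 v))
      ((gaussianReal 0 v).prod (gaussianReal 0 v)) := by
  have hneg := (MeasurePreserving.id (gaussianReal 0 v)).prod (measurePreserving_neg_gaussianReal v)
  convert (measurePreserving_reflection v hab).comp hneg using 1
  funext p
  simp [Prod.map, sub_eq_add_neg]

lemma map_sum_pi_gaussianReal (N : ℕ) (v : NNReal) :
    (Measure.pi fun _ : Fin N => gaussianReal 0 v).map (fun x => ∑ i, x i) =
      gaussianReal 0 (N * v) := by
  have hind : iIndepFun (fun (i : Fin N) (x : Fin N → ℝ) => x i)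
      (Measure.pi fun _ : Fin N => gaussianReal 0 v) :=
    iIndepFun_pi (X := fun _ => id) fun _ => aemeasurable_id
  have hlaw (i : Fin N) : (Measure.pi fun _ : Fin N => gaussianReal 0 v).map (fun x => x i) =
      gaussianReal 0 v := (measurePreserving_eval (fun _ : Fin N => gaussianReal 0 v) i).map_eq
  have key (S : Finset (Fin N)) :
      (Measure.pi fun _ : Fin N => gaussianReal 0 v).map (∑ i ∈ S, fun x : Fin N → ℝ => x i) =
        gaussianReal 0 (S.card * v) := by
    induction S using Finset.induction_on with
    | empty => simp [gaussianReal_zero_var, Pi.zero_def, Measure.map_const]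
    | insert a S ha ih =>
      rw [Finset.sum_insert ha]
      have := gaussianReal_add_gaussianReal_of_indepFun
        (hind.indepFun_finsetSum_of_notMem (fun i => measurable_pi_apply i) ha).symm (hlaw a) ih
      rw [this, Finset.card_insert_of_notMem ha]
      congr 1 <;> push_cast <;> ring
  have := key Finset.univ
  rw [Finset.card_univ, Fintype.card_fin] at this
  rw [← this]
  congr 1
  ext x
  simp

/-! ### Exchanging independent coordinates according to independent signs -/

open Classical in
/-- The pair `(ξ q, ξ p)` or `(ξ p, ξ q)`, according to whether `D` classifies `p` and `q` alike. -/
def signedSwap {α β : Type*} (D : Set α) (ξ : α → β) (z : α × α) : β × β :=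
  if (z.1 ∈ D ↔ z.2 ∈ D) then (ξ z.2, ξ z.1) else (ξ z.1, ξ z.2)

lemma measurable_signedSwap {α β : Type*} [MeasurableSpace α] [MeasurableSpace β]
    {D : Set α} (hD : MeasurableSet D) {ξ : α → β} (hξ : Measurable ξ) :
    Measurable (signedSwap D ξ) := by
  have h1 : MeasurableSet {z : α × α | z.1 ∈ D} := measurable_fst hD
  have h2 : MeasurableSet {z : α × α | z.2 ∈ D} := measurable_snd hD
  classical
  exact Measurable.ite (h1.iff h2) ((hξ.comp measurable_snd).prodMk (hξ.comp measurable_fst))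
    ((hξ.comp measurable_fst).prodMk (hξ.comp measurable_snd))

/-- By `hsym`, membership in `D` is a fair coin independent of `ξ`. Each of the four class
combinations of the pair therefore carries a quarter of the product mass, whichever order the values
are listed in. -/
lemma measurePreserving_signedSwap {α β : Type*} [MeasurableSpace α] [MeasurableSpace β]
    (m : Measure α) [IsProbabilityMeasure m] {D : Set α} (hD : MeasurableSet D) {ξ : α → β}
    (hξ : Measurable ξ)
    (hsym : ∀ T, MeasurableSet T → m (D ∩ ξ ⁻¹' T) = m (Dᶜ ∩ ξ ⁻¹' T)) :
    MeasurePreserving (signedSwap D ξ) (m.prod m) ((m.map ξ).prod (m.map ξ)) := by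
  have hmeas := measurable_signedSwap hD hξ
  have : IsProbabilityMeasure (m.map ξ) := Measure.isProbabilityMeasure_map hξ.aemeasurable
  refine ⟨hmeas, (Measure.prod_eq fun S T hS hT => ?_).symm⟩
  rw [Measure.map_apply hmeas (hS.prod hT), Measure.map_apply hξ hS, Measure.map_apply hξ hT]
  have hpre : signedSwap D ξ ⁻¹' (S ×ˢ T) =
      (((D ∩ ξ ⁻¹' T) ×ˢ (D ∩ ξ ⁻¹' S)) ∪ ((Dᶜ ∩ ξ ⁻¹' T) ×ˢ (Dᶜ ∩ ξ ⁻¹' S))) ∪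
      (((D ∩ ξ ⁻¹' S) ×ˢ (Dᶜ ∩ ξ ⁻¹' T)) ∪ ((Dᶜ ∩ ξ ⁻¹' S) ×ˢ (D ∩ ξ ⁻¹' T))) := by
    ext ⟨p, q⟩
    by_cases hp : p ∈ D <;> by_cases hq : q ∈ D <;> simp [signedSwap, hp, hq, and_comm]
  have hDS := hD.inter (hξ hS)
  have hDT := hD.inter (hξ hT)
  have hcS := hD.compl.inter (hξ hS)
  have hcT := hD.compl.inter (hξ hT)
  have hhalf (A : Set β) (hA : MeasurableSet A) :
      m (ξ ⁻¹' A) = m (D ∩ ξ ⁻¹' A) + m (D ∩ ξ ⁻¹' A) := by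
    conv_rhs => rw [hsym A hA]
    nth_rw 1 [← hsym A hA]
    rw [Set.inter_comm D, Set.inter_comm Dᶜ, ← Set.sdiff_eq, measure_inter_add_sdiff _ hD]
  rw [hpre, measure_union _ ((hDS.prod hcT).union (hcS.prod hDT)),
    measure_union _ (hcT.prod hcS), measure_union _ (hcS.prod hDT)]
  · simp only [Measure.prod_prod, ← hsym S hS, ← hsym T hT]
    rw [hhalf S hS, hhalf T hT]
    ring
  all_goals
    rw [Set.disjoint_left]
    rintro ⟨p, q⟩
    simp only [Set.mem_union, Set.mem_prod, Set.mem_inter_iff, Set.mem_compl_iff]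
    tauto

/-! ### The QPSK quantizer off the coordinate axes -/

/-- The sign `±1` of a real number, with value `-1` at `0`. -/
def sgn (x : ℝ) : ℝ := if 0 < x then 1 else -1

lemma sgn_of_pos {x : ℝ} (h : 0 < x) : sgn x = 1 := if_pos h

lemma sgn_of_nonpos {x : ℝ} (h : x ≤ 0) : sgn x = -1 := if_neg h.not_gt

lemma sgn_eq_or (x : ℝ) : sgn x = 1 ∨ sgn x = -1 := by
  unfold sgn; split_ifs <;> simp

lemma sgn_mul_self (x : ℝ) : sgn x * x = |x| := by
  rcases lt_or_ge 0 x with h | h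
  · rw [sgn_of_pos h, abs_of_pos h, one_mul]
  · rw [sgn_of_nonpos h, abs_of_nonpos h, neg_one_mul]

lemma sgn_eq_iff {c y : ℝ} (hc : c = 1 ∨ c = -1) (hy : y ≠ 0) : sgn y = c ↔ 0 < c * y := by
  unfold sgn
  rcases hc with rfl | rfl <;> rcases lt_or_gt_of_ne hy with h | h <;>
    simp [h, h.not_gt] <;> norm_num

lemma measurable_sgn : Measurable sgn :=
  Measurable.ite measurableSet_Ioi measurable_const measurable_const

/-- The point `(a + bj)/√2`. -/
def qpskPoint (a b : ℝ) : ℂ := ⟨a / Real.sqrt 2, b / Real.sqrt 2⟩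

lemma exp_quarter_turns (i : ℕ) :
    Complex.exp (((Real.pi / 4 + 2 * Real.pi / (4 : ℕ) * i : ℝ) : ℂ) * Complex.I) =
      qpskPoint 1 1 * Complex.I ^ i := by
  have h1 : Complex.exp (((Real.pi / 4 : ℝ) : ℂ) * Complex.I) = qpskPoint 1 1 := by
    rw [Complex.exp_mul_I, ← Complex.ofReal_cos, ← Complex.ofReal_sin, Real.cos_pi_div_four,
      Real.sin_pi_div_four]
    have : Real.sqrt 2 / 2 = 1 / Real.sqrt 2 := by
      rw [div_eq_div_iff (by norm_num) (by positivity)]; norm_num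
    apply Complex.ext <;> simp [qpskPoint, this]
  have hI : Complex.I ^ i = Complex.exp (i * (Real.pi / 2 * Complex.I)) := by
    rw [Complex.exp_nat_mul, Complex.exp_pi_div_two_mul_I]
  rw [← h1, hI, ← Complex.exp_add]
  congr 1
  push_cast
  ring

lemma mem_pskConstellation_four {z : ℂ} :
    z ∈ pskConstellation 4 ↔ ∃ a b : ℝ, (a = 1 ∨ a = -1) ∧ (b = 1 ∨ b = -1) ∧
      z = qpskPoint a b := by
  simp only [pskConstellation, Set.mem_ofPred_eq, exp_quarter_turns]
  constructor
  · rintro ⟨i, hi, rfl⟩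
    interval_cases i
    · exact ⟨1, 1, by simp, by simp, by simp⟩
    · exact ⟨-1, 1, by simp, by simp, by apply Complex.ext <;> simp [qpskPoint, neg_div]⟩
    · exact ⟨-1, -1, by simp, by simp, by apply Complex.ext <;> simp [qpskPoint, neg_div]⟩
    · exact ⟨1, -1, by simp, by simp, by
        apply Complex.ext <;> simp [qpskPoint, neg_div, Complex.I_pow_three]⟩
  · rintro ⟨a, b, rfl | rfl, rfl | rfl, rfl⟩
    · exact ⟨0, by norm_num, by simp⟩
    · exact ⟨3, by norm_num, by
        apply Complex.ext <;> simp [qpskPoint, neg_div, Complex.I_pow_three]⟩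
    · exact ⟨1, by norm_num, by apply Complex.ext <;> simp [qpskPoint, neg_div]⟩
    · exact ⟨2, by norm_num, by apply Complex.ext <;> simp [qpskPoint, neg_div]⟩

lemma finite_pskConstellation (M : ℕ) : (pskConstellation M).Finite := by
  refine ((Set.finite_Iio M).image fun i : ℕ =>
    Complex.exp (((Real.pi / 4 + 2 * Real.pi / M * i : ℝ) : ℂ) * Complex.I)).subset ?_
  rintro z ⟨i, hi, rfl⟩
  exact ⟨i, hi, rfl⟩

/-- All four points have modulus one, so minimising the distance amounts to maximising `a * x.re + b
* x.im`. -/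
lemma norm_qpskPoint_sub_sq {a b : ℝ} (ha : a = 1 ∨ a = -1) (hb : b = 1 ∨ b = -1) (x : ℂ) :
    ‖qpskPoint a b - x‖ ^ 2 =
      1 - Real.sqrt 2 * (a * x.re + b * x.im) + (x.re ^ 2 + x.im ^ 2) := by
  have h2 : Real.sqrt 2 ^ 2 = 2 := Real.sq_sqrt (by norm_num)
  have h0 : Real.sqrt 2 ≠ 0 := by positivity
  have ha2 : a ^ 2 = 1 := by rcases ha with rfl | rfl <;> norm_num
  have hb2 : b ^ 2 = 1 := by rcases hb with rfl | rfl <;> norm_num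
  have hinv' : (Real.sqrt 2)⁻¹ = Real.sqrt 2 / 2 := by field_simp; nlinarith
  rw [← Complex.normSq_eq_norm_sq, Complex.normSq_apply]
  simp only [qpskPoint, Complex.sub_re, Complex.sub_im, div_eq_mul_inv]
  rw [hinv']
  linear_combination (a ^ 2 + b ^ 2) / 4 * h2 + (1 / 2) * ha2 + (1 / 2) * hb2

/-- The largest possible correlation is `|x.re| + |x.im|`, and off the axes it is attained only by
the two signs. Tie-breaking thus matters only on a null set. -/
lemma IsPhaseQuantizer.apply_eq {Q : ℂ → ℂ} (hQ : IsPhaseQuantizer 2 Q) {x : ℂ}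
    (hre : x.re ≠ 0) (him : x.im ≠ 0) : Q x = qpskPoint (sgn x.re) (sgn x.im) := by
  obtain ⟨hmem, hmin⟩ := hQ x
  norm_num at hmem hmin
  obtain ⟨a, b, ha, hb, hab⟩ := mem_pskConstellation_four.1 hmem
  have hle := hmin _ (mem_pskConstellation_four.2
    ⟨_, _, sgn_eq_or x.re, sgn_eq_or x.im, rfl⟩)
  rw [hab] at hle ⊢
  have hsq := pow_le_pow_left₀ (norm_nonneg _) hle 2
  rw [norm_qpskPoint_sub_sq ha hb, norm_qpskPoint_sub_sq (sgn_eq_or _) (sgn_eq_or _),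
    sgn_mul_self, sgn_mul_self] at hsq
  have h0 : 0 < Real.sqrt 2 := by positivity
  have hge : |x.re| + |x.im| ≤ a * x.re + b * x.im := by
    by_contra! hlt
    have := mul_lt_mul_of_pos_left hlt h0
    linarith
  have hpa : 0 < |x.re| := abs_pos.2 hre
  have hpb : 0 < |x.im| := abs_pos.2 him
  have hle' {c y : ℝ} (hc : c = 1 ∨ c = -1) : c * y ≤ |y| := by
    rcases hc with rfl | rfl
    · simpa using le_abs_self y
    · simpa using neg_le_abs y
  have h1 := hle' (y := x.re) ha
  have h2 := hle' (y := x.im) hb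
  rw [(sgn_eq_iff ha hre).2 (by linarith), (sgn_eq_iff hb him).2 (by linarith)]

lemma qpskPoint_injective {a b c d : ℝ} (h : qpskPoint a b = qpskPoint c d) : a = c ∧ b = d := by
  have h0 : Real.sqrt 2 ≠ 0 := by positivity
  have h1 := congrArg Complex.re h
  have h2 := congrArg Complex.im h
  simp only [qpskPoint] at h1 h2
  exact ⟨by field_simp at h1; exact h1, by field_simp at h2; exact h2⟩

lemma IsPhaseQuantizer.apply_eq_iff {Q : ℂ → ℂ} (hQ : IsPhaseQuantizer 2 Q) {x : ℂ}
    (hre : x.re ≠ 0) (him : x.im ≠ 0) {a b : ℝ} (ha : a = 1 ∨ a = -1) (hb : b = 1 ∨ b = -1) :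
    Q x = qpskPoint a b ↔ 0 < a * x.re ∧ 0 < b * x.im := by
  rw [hQ.apply_eq hre him]
  rw [← sgn_eq_iff ha hre, ← sgn_eq_iff hb him]
  exact ⟨qpskPoint_injective, fun h => by rw [h.1, h.2]⟩

lemma norm_qpskPoint {a b : ℝ} (ha : a = 1 ∨ a = -1) (hb : b = 1 ∨ b = -1) :
    ‖qpskPoint a b‖ = 1 := by
  have := norm_qpskPoint_sub_sq ha hb 0
  simp only [sub_zero, Complex.zero_re, Complex.zero_im, mul_zero, add_zero] at this
  have h := norm_nonneg (qpskPoint a b)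
  nlinarith

/-! ### The statistic `Z` -/

/-- A real-coordinate expression for `statZ` off the coordinate axes. -/
lemma statZ_eq {Q : ℂ → ℂ} (hQ : IsPhaseQuantizer 2 Q) {g : ℂ} (hre : g.re ≠ 0)
    (him : g.im ≠ 0) :
    statZ Q g = (signedSwap (Set.Ioi 0) (fun x : ℝ => Real.sqrt 2 * |x|) (g.re, g.im)).2 := by
  have hs := sgn_eq_or g.re
  have hs' := sgn_eq_or g.im
  have hn := norm_qpskPoint hs hs'
  have hq0 : qpskPoint (sgn g.re) (sgn g.im) ≠ 0 := by
    intro h; rw [h] at hn; simp at hn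
  have hg0 : g ≠ 0 := fun h => hre (by simp [h])
  have hgn : ‖g‖ ≠ 0 := norm_ne_zero_iff.2 hg0
  have h2 : Real.sqrt 2 ^ 2 = 2 := Real.sq_sqrt (by norm_num)
  have h0 : Real.sqrt 2 ≠ 0 := by positivity
  have hval : statZ Q g = Real.sqrt 2 / 2 * (sgn g.re * g.re + sgn g.im * g.im
      - sgn g.re * g.im + sgn g.im * g.re) := by
    rw [statZ, hQ.apply_eq hre him, Real.cos_add, Real.cos_sub, Real.sin_sub,
      Complex.cos_arg hg0, Complex.sin_arg, Complex.cos_arg hq0, Complex.sin_arg, hn,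
      Real.cos_pi_div_four, Real.sin_pi_div_four]
    simp only [qpskPoint]
    field_simp
    ring
  rw [hval, signedSwap]
  simp only [Set.mem_Ioi]
  unfold sgn
  -- With equal signs the imaginary terms cancel and `√2 |Re g|` remains; with opposite signs the
  -- real terms cancel and `√2 |Im g|` remains.
  rcases lt_or_gt_of_ne hre with h | h <;> rcases lt_or_gt_of_ne him with h' | h' <;>
    simp [h, h', h.not_gt, h'.not_gt, abs_of_pos, abs_of_neg] <;> ring

/-! ### The half-normal law -/

lemma gaussianReal_singleton {v : NNReal} (hv : v ≠ 0) (x : ℝ) : gaussianReal 0 v {x} = 0 := by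
  have := nullSingletonClass_gaussianReal (μ := 0) hv
  exact measure_singleton x

/-- Negation exchanges the two half-lines up to the null set `{0}`: the sign of a centred Gaussian
is a fair coin independent of its modulus. -/
lemma gaussianReal_inter_Ioi_eq {v : NNReal} (hv : v ≠ 0) {S : Set ℝ} (hS : MeasurableSet S)
    (hneg : ∀ x, x ∈ S ↔ -x ∈ S) :
    gaussianReal 0 v (Set.Ioi 0 ∩ S) = gaussianReal 0 v ((Set.Ioi 0)ᶜ ∩ S) := by
  rw [← (measurePreserving_neg_gaussianReal v).measure_preimage
    (measurableSet_Ioi.inter hS).nullMeasurableSet]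
  have h0 : ∀ᵐ x ∂gaussianReal 0 v, x ≠ 0 := by
    rw [ae_iff]
    simpa using gaussianReal_singleton hv 0
  refine measure_congr (eventuallyEq_set.2 ?_)
  filter_upwards [h0] with x hx
  simp only [Set.mem_preimage, Set.mem_inter_iff, Set.mem_compl_iff, Set.mem_Ioi, ← hneg x,
    Left.neg_pos_iff, not_lt]
  exact and_congr_left fun _ => ⟨le_of_lt, fun h => lt_of_le_of_ne h hx⟩

lemma map_abs_gaussianReal : (gaussianReal 0 1).map (fun x => |x|) = halfNormal := by
  have hm : Measurable fun x : ℝ => |x| := measurable_id.abs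
  ext S hS
  have hT := hm hS
  have h := gaussianReal_inter_Ioi_eq one_ne_zero hT (by simp)
  rw [Measure.map_apply hm hS, ← measure_inter_add_sdiff _ (measurableSet_Ioi (a := (0 : ℝ))),
    Set.sdiff_eq, Set.inter_comm, Set.inter_comm _ (Set.Ioi 0)ᶜ, ← h, ← two_mul,
    gaussianReal_apply _ one_ne_zero, halfNormal, withDensity_apply _ hS,
    ← lintegral_const_mul _ (measurable_gaussianPDF _ _),
    ← lintegral_indicator (measurableSet_Ioi.inter hT), ← lintegral_indicator hS]
  refine lintegral_congr_ae ?_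
  have h0 : ∀ᵐ x : ℝ ∂volume, x ≠ 0 := by simp [ae_iff]
  filter_upwards [h0] with x hx
  have hc : 2 * (Real.sqrt (2 * Real.pi))⁻¹ = Real.sqrt (2 / Real.pi) := by
    rw [Real.sqrt_div (by norm_num), Real.sqrt_mul (by norm_num)]
    have : Real.sqrt 2 * Real.sqrt 2 = 2 := Real.mul_self_sqrt (by norm_num)
    field_simp
    nlinarith
  rcases lt_or_gt_of_ne hx with hx' | hx'
  · rw [Set.indicator_of_notMem (by simp [hx'.le])]
    by_cases hxS : x ∈ S <;> simp [hxS, hx'.not_ge]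
  · by_cases hxS : x ∈ S
    · rw [Set.indicator_of_mem (by simp [hx', abs_of_pos hx', hxS]), Set.indicator_of_mem hxS,
        if_pos hx'.le, gaussianPDF, gaussianPDFReal, ← hc,
        ← ENNReal.ofReal_ofNat, ← ENNReal.ofReal_mul (by norm_num)]
      simp [mul_assoc]
    · rw [Set.indicator_of_notMem (by simp [hx', abs_of_pos hx', hxS]),
        Set.indicator_of_notMem hxS]

instance : IsProbabilityMeasure halfNormal := by
  rw [← map_abs_gaussianReal]
  exact Measure.isProbabilityMeasure_map (by fun_prop)

lemma measurePreserving_sqrt_two_mul :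
    MeasurePreserving (fun x => Real.sqrt 2 * x) (gaussianReal 0 (1 / 2)) (gaussianReal 0 1) := by
  refine ⟨by fun_prop, ?_⟩
  rw [gaussianReal_map_const_mul, mul_zero]
  congr 1
  ext
  simp

lemma measurePreserving_sqrt_two_mul_abs :
    MeasurePreserving (fun x => Real.sqrt 2 * |x|) (gaussianReal 0 (1 / 2)) halfNormal := by
  have h1 : MeasurePreserving (fun x : ℝ => |x|) (gaussianReal 0 1) halfNormal :=
    ⟨by fun_prop, map_abs_gaussianReal⟩
  convert h1.comp measurePreserving_sqrt_two_mul using 1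
  funext x
  simp [abs_mul, abs_of_nonneg (Real.sqrt_nonneg 2)]

/-! ### The complex Gaussian law -/

lemma measurable_ofReal_add_mul_I :
    Measurable fun p : ℝ × ℝ => (p.1 : ℂ) + (p.2 : ℂ) * Complex.I := by fun_prop

instance : IsProbabilityMeasure complexGaussian :=
  Measure.isProbabilityMeasure_map measurable_ofReal_add_mul_I.aemeasurable

instance (N : ℕ) : IsProbabilityMeasure (complexGaussianVec N) := by
  unfold complexGaussianVec; infer_instance

lemma measurePreserving_re_im :
    MeasurePreserving (fun z : ℂ => (z.re, z.im)) complexGaussian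
      ((gaussianReal 0 (1 / 2)).prod (gaussianReal 0 (1 / 2))) := by
  refine ⟨by fun_prop, ?_⟩
  rw [complexGaussian, Measure.map_map (by fun_prop) measurable_ofReal_add_mul_I]
  convert Measure.map_id using 2
  funext p
  simp

lemma ae_re_ne_zero_and_im_ne_zero : ∀ᵐ z ∂complexGaussian, z.re ≠ 0 ∧ z.im ≠ 0 := by
  have hv : (1 / 2 : NNReal) ≠ 0 := by norm_num
  have h0 : ∀ᵐ x ∂gaussianReal 0 (1 / 2), x ≠ 0 := by
    rw [ae_iff]
    simpa using gaussianReal_singleton hv 0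
  have h1 := (measurePreserving_fst.comp measurePreserving_re_im).quasiMeasurePreserving.ae h0
  have h2 := (measurePreserving_snd.comp measurePreserving_re_im).quasiMeasurePreserving.ae h0
  filter_upwards [h1, h2] with z hz hz'
  exact ⟨hz, hz'⟩

/-! ### The law of the statistics `Zᵢ` -/

lemma hasLaw_statZ {Q : ℂ → ℂ} (hQ : IsPhaseQuantizer 2 Q) :
    HasLaw (statZ Q) halfNormal complexGaussian := by
  have hK := measurePreserving_signedSwap (gaussianReal 0 (1 / 2)) (measurableSet_Ioi (a := (0 : ℝ)))
    (ξ := fun x : ℝ => Real.sqrt 2 * |x|) (by fun_prop)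
    (fun T hT => gaussianReal_inter_Ioi_eq (by norm_num)
      ((by fun_prop : Measurable fun x : ℝ => Real.sqrt 2 * |x|) hT) (by simp))
  rw [measurePreserving_sqrt_two_mul_abs.map_eq] at hK
  refine ((measurePreserving_snd.comp hK).comp measurePreserving_re_im).hasLaw.congr ?_
  filter_upwards [ae_re_ne_zero_and_im_ne_zero] with z hz
  exact statZ_eq hQ hz.1 hz.2

lemma hasLaw_eval {Ω : Type*} [MeasurableSpace Ω] {P : Measure Ω} {N : ℕ} {h : Ω → Fin N → ℂ}
    (hh : HasLaw h (complexGaussianVec N) P) (i : Fin N) :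
    HasLaw (fun ω => h ω i) complexGaussian P :=
  (measurePreserving_eval (fun _ : Fin N => complexGaussian) i).hasLaw.comp hh

lemma hasLaw_statZ_comp {Ω : Type*} [MeasurableSpace Ω] {P : Measure Ω} {N : ℕ}
    {h : Ω → Fin N → ℂ} (hh : HasLaw h (complexGaussianVec N) P) {Q : ℂ → ℂ}
    (hQ : IsPhaseQuantizer 2 Q) (i : Fin N) :
    HasLaw (fun ω => statZ Q (h ω i)) halfNormal P :=
  (hasLaw_statZ hQ).comp (hasLaw_eval hh i)

lemma iIndepFun_statZ {Ω : Type*} [MeasurableSpace Ω] {P : Measure Ω} [IsProbabilityMeasure P]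
    {N : ℕ} {h : Ω → Fin N → ℂ} (hh : HasLaw h (complexGaussianVec N) P) {Q : ℂ → ℂ}
    (hQ : IsPhaseQuantizer 2 Q) : iIndepFun (fun i ω => statZ Q (h ω i)) P := by
  have h1 : iIndepFun (fun i ω => h ω i) P := by
    rw [iIndepFun_iff_map_fun_eq_pi_map fun i => (hasLaw_eval hh i).aemeasurable]
    simp_rw [(hasLaw_eval hh _).map_eq]
    exact hh.map_eq
  -- Arbitrary tie-breaking may make `statZ Q` non-measurable, so independence is transported
  -- through a measurable modification.
  obtain ⟨g, hg, hge⟩ := (hasLaw_statZ hQ).aemeasurable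
  refine (h1.comp (fun _ => g) (fun _ => hg)).congr fun i => ?_
  rw [← (hasLaw_eval hh i).map_eq] at hge
  exact (ae_of_ae_map (hasLaw_eval hh i).aemeasurable hge).mono fun ω hω => hω.symm

/-- The vector of the statistics `Zᵢ` has the product half-normal law. -/
lemma hasLaw_statZ_vec {Ω : Type*} [MeasurableSpace Ω] {P : Measure Ω} [IsProbabilityMeasure P]
    {N : ℕ} {h : Ω → Fin N → ℂ} (hh : HasLaw h (complexGaussianVec N) P) {Q : ℂ → ℂ}
    (hQ : IsPhaseQuantizer 2 Q) :
    HasLaw (fun ω i => statZ Q (h ω i)) (Measure.pi fun _ : Fin N => halfNormal) P := by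
  have := (iIndepFun_iff_map_fun_eq_pi_map
    fun i => (hasLaw_statZ_comp hh hQ i).aemeasurable).1 (iIndepFun_statZ hh hQ)
  simp_rw [(hasLaw_statZ_comp hh hQ _).map_eq] at this
  exact ⟨aemeasurable_pi_lambda _ fun i => (hasLaw_statZ_comp hh hQ i).aemeasurable, this⟩

/-! ### The Gaussian `Q`-function -/

lemma gaussQ_eq (x : ℝ) : gaussQ x = (gaussianReal 0 1).real (Set.Ioi x) := by
  rw [measureReal_def, gaussianReal_apply_eq_integral 0 one_ne_zero, ENNReal.toReal_ofReal
    (setIntegral_nonneg measurableSet_Ioi fun y _ => gaussianPDFReal_nonneg 0 1 y), gaussQ,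
    ← integral_const_mul]
  simp [gaussianPDFReal]

lemma gaussQ_nonneg (x : ℝ) : 0 ≤ gaussQ x := by
  rw [gaussQ_eq]; exact measureReal_nonneg

lemma gaussQ_le_one (x : ℝ) : gaussQ x ≤ 1 := by
  rw [gaussQ_eq]; exact measureReal_le_one

lemma antitone_gaussQ : Antitone gaussQ := fun x y hxy => by
  rw [gaussQ_eq, gaussQ_eq]
  exact measureReal_mono (Set.Ioi_subset_Ioi hxy)

lemma measurable_gaussQ : Measurable gaussQ := antitone_gaussQ.measurable

lemma ofReal_gaussQ (x : ℝ) : ENNReal.ofReal (gaussQ x) = gaussianReal 0 1 (Set.Ioi x) := by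
  rw [gaussQ_eq, ofReal_measureReal]

lemma gaussianReal_Iic_neg {N : ℕ} (hN : N ≠ 0) (t : ℝ) :
    gaussianReal 0 N (Set.Iic (-t)) = ENNReal.ofReal (gaussQ (t / Real.sqrt N)) := by
  have hN0 : 0 < Real.sqrt N := Real.sqrt_pos.2 (by positivity)
  have hmp : MeasurePreserving (fun x => -(Real.sqrt N * x)) (gaussianReal 0 1)
      (gaussianReal 0 N) := by
    refine (measurePreserving_neg_gaussianReal N).comp ⟨by fun_prop, ?_⟩
    rw [gaussianReal_map_const_mul, mul_zero]
    congr 1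
    ext
    simp
  rw [ofReal_gaussQ, ← hmp.measure_preimage measurableSet_Iic.nullMeasurableSet]
  have := nullSingletonClass_gaussianReal (μ := 0) (one_ne_zero (α := NNReal))
  rw [← measure_congr (Ioi_ae_eq_Ici (μ := gaussianReal 0 1)).symm]
  congr 1
  ext x
  simp [div_le_iff₀ hN0, mul_comm]

/-! ### The law of a combined branch output -/

/-- The component `x` of the channel gain along one quadrature axis, multiplied by the sign of the
received component `√ρ x + n`. -/
def alignedGain (ρ : ℝ) (z : ℝ × ℝ) : ℝ := sgn (Real.sqrt ρ * z.1 + z.2) * z.1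

/-- Channel and noise components for which the received component is positive. -/
def positiveOutput (ρ : ℝ) : Set (ℝ × ℝ) := {z | 0 < Real.sqrt ρ * z.1 + z.2}

lemma measurable_alignedGain (ρ : ℝ) : Measurable (alignedGain ρ) := by
  unfold alignedGain
  exact (measurable_sgn.comp (by fun_prop)).mul measurable_fst

lemma measurableSet_positiveOutput (ρ : ℝ) : MeasurableSet (positiveOutput ρ) :=
  measurableSet_lt measurable_const (by fun_prop)

/-- The law of `alignedGain` for independent `N(0, 1/2)` channel and noise components. -/
def alignedGainLaw (ρ : ℝ) : Measure ℝ :=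
  ((gaussianReal 0 (1 / 2)).prod (gaussianReal 0 (1 / 2))).map (alignedGain ρ)

instance (ρ : ℝ) : IsProbabilityMeasure (alignedGainLaw ρ) :=
  Measure.isProbabilityMeasure_map (measurable_alignedGain ρ).aemeasurable

lemma reflection_coefficients {ρ : ℝ} (hρ : 0 < ρ) :
    (Real.sqrt ρ / Real.sqrt (1 + ρ)) ^ 2 + (1 / Real.sqrt (1 + ρ)) ^ 2 = 1 := by
  rw [div_pow, div_pow, Real.sq_sqrt hρ.le, Real.sq_sqrt (by positivity)]
  field_simp
  ring

/-- Divided by `√(1 + ρ)`, the output is the first coordinate of an orthogonal image of the Gaussian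
pair, hence has no atom. -/
lemma ae_output_ne_zero {ρ : ℝ} (hρ : 0 < ρ) :
    ∀ᵐ z ∂(gaussianReal 0 (1 / 2)).prod (gaussianReal 0 (1 / 2)),
      Real.sqrt ρ * z.1 + z.2 ≠ 0 := by
  have h0 : ∀ᵐ x ∂gaussianReal 0 (1 / 2), x ≠ 0 := by
    rw [ae_iff]
    simpa using gaussianReal_singleton (v := 1 / 2) (by norm_num) 0
  have h1 := (measurePreserving_fst.comp (measurePreserving_reflection (1 / 2)
    (reflection_coefficients hρ))).quasiMeasurePreserving.ae h0
  filter_upwards [h1] with z hz hz'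
  apply hz
  simp only [Function.comp]
  have : Real.sqrt ρ / Real.sqrt (1 + ρ) * z.1 + 1 / Real.sqrt (1 + ρ) * z.2 =
    (Real.sqrt ρ * z.1 + z.2) / Real.sqrt (1 + ρ) := by ring
  rw [this, hz', zero_div]

lemma sgn_neg_of_ne_zero {x : ℝ} (hx : x ≠ 0) : sgn (-x) = -sgn x := by
  unfold sgn
  rcases lt_or_gt_of_ne hx with h | h <;> simp [h, h.not_gt]

/-- Negating channel and noise together flips the output sign and leaves `alignedGain` fixed, since
both its factors change sign. This is the symmetry required by `measurePreserving_signedSwap`. -/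
lemma measure_positiveOutput_inter {ρ : ℝ} (hρ : 0 < ρ) {T : Set ℝ} (hT : MeasurableSet T) :
    ((gaussianReal 0 (1 / 2)).prod (gaussianReal 0 (1 / 2)))
        (positiveOutput ρ ∩ alignedGain ρ ⁻¹' T) =
      ((gaussianReal 0 (1 / 2)).prod (gaussianReal 0 (1 / 2)))
        ((positiveOutput ρ)ᶜ ∩ alignedGain ρ ⁻¹' T) := by
  have hneg := (measurePreserving_neg_gaussianReal (1 / 2)).prod
    (measurePreserving_neg_gaussianReal (1 / 2))
  rw [← hneg.measure_preimage
    ((measurableSet_positiveOutput ρ).inter (measurable_alignedGain ρ hT)).nullMeasurableSet]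
  refine measure_congr (eventuallyEq_set.2 ?_)
  filter_upwards [ae_output_ne_zero hρ] with z hz
  have h1 : Real.sqrt ρ * -z.1 + -z.2 = -(Real.sqrt ρ * z.1 + z.2) := by ring
  simp only [Set.mem_preimage, Set.mem_inter_iff, Set.mem_compl_iff, positiveOutput,
    Set.mem_ofPred_eq, alignedGain, Prod.map, h1, sgn_neg_of_ne_zero hz, neg_mul_neg,
    Left.neg_pos_iff, not_lt]
  exact and_congr_left fun _ => ⟨le_of_lt, fun h => lt_of_le_of_ne h hz⟩

/-- Given the first coordinate, the second is multiplied by a constant `±1`, which preserves its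
symmetric law. -/
lemma measurePreserving_sgn_mul (v : NNReal) :
    MeasurePreserving (fun p : ℝ × ℝ => (p.1, sgn p.1 * p.2))
      ((gaussianReal 0 v).prod (gaussianReal 0 v))
      ((gaussianReal 0 v).prod (gaussianReal 0 v)) := by
  refine (MeasurePreserving.id (gaussianReal 0 v)).skew_product
    (g := fun x y => sgn x * y) ((measurable_sgn.comp measurable_fst).mul measurable_snd) ?_
  refine ae_of_all _ fun x => ?_
  rcases sgn_eq_or x with h | h
  · simp [h]
  · simpa [h] using (measurePreserving_neg_gaussianReal v).map_eq

/-- The aligned gain is distributed as a normalised sum of a half-normal signal part and an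
independent Gaussian part. -/
lemma measurePreserving_alignedGainLaw {ρ : ℝ} (hρ : 0 < ρ) :
    MeasurePreserving
      (fun q : ℝ × ℝ => (Real.sqrt ρ * q.1 + q.2) / (Real.sqrt 2 * Real.sqrt (1 + ρ)))
      (halfNormal.prod (gaussianReal 0 1)) (alignedGainLaw ρ) := by
  -- With `u = (√ρ x + n) / √(1 + ρ)` and `v = (x - √ρ n) / √(1 + ρ)`, the involution gives `x = (√ρ
  -- u + v) / √(1 + ρ)`. Multiplying by `sgn u` produces `|u|` and `sgn u * v`; the factor `√2`
  -- normalises their scale.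
  have hR := measurePreserving_reflection (1 / 2) (reflection_coefficients hρ)
  have hS := (measurePreserving_sgn_mul (1 / 2)).comp hR
  have hA := (measurePreserving_sqrt_two_mul_abs.prod measurePreserving_sqrt_two_mul).comp hS
  refine ⟨by fun_prop, ?_⟩
  rw [← hA.map_eq, Measure.map_map (by fun_prop) hA.measurable, alignedGainLaw]
  congr 1
  funext z
  have h2 : Real.sqrt 2 ≠ 0 := by positivity
  have h1 : 0 < Real.sqrt (1 + ρ) := Real.sqrt_pos.2 (by positivity)
  have hsq : Real.sqrt (1 + ρ) ^ 2 = 1 + Real.sqrt ρ ^ 2 := by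
    rw [Real.sq_sqrt (by positivity), Real.sq_sqrt hρ.le]
  have hp : Real.sqrt ρ / Real.sqrt (1 + ρ) * z.1 + 1 / Real.sqrt (1 + ρ) * z.2 =
    (Real.sqrt ρ * z.1 + z.2) / Real.sqrt (1 + ρ) := by ring
  have hsgn : sgn ((Real.sqrt ρ * z.1 + z.2) / Real.sqrt (1 + ρ)) =
      sgn (Real.sqrt ρ * z.1 + z.2) := by
    simp [sgn, div_pos_iff_of_pos_right h1]
  simp only [Function.comp, Prod.map, hp, ← sgn_mul_self, hsgn, alignedGain]
  field_simp
  linear_combination (-(sgn (Real.sqrt ρ * z.1 + z.2) * z.1)) * hsq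

lemma measurePreserving_alignedGainLaw_pi {ρ : ℝ} (hρ : 0 < ρ) (N : ℕ) :
    MeasurePreserving (fun (q : (Fin N → ℝ) × (Fin N → ℝ)) (i : Fin N) =>
      (Real.sqrt ρ * q.1 i + q.2 i) / (Real.sqrt 2 * Real.sqrt (1 + ρ)))
      ((Measure.pi fun _ => halfNormal).prod (Measure.pi fun _ => gaussianReal 0 1))
      (Measure.pi fun _ => alignedGainLaw ρ) :=
  (measurePreserving_pi (fun _ : Fin N => halfNormal.prod (gaussianReal 0 1)) _
    fun _ => measurePreserving_alignedGainLaw hρ).comp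
    (measurePreserving_arrowProdEquivProdArrow ℝ ℝ (Fin N) (fun _ => halfNormal)
      (fun _ => gaussianReal 0 1)).symm

/-- The average of `Q(√ρ T)` over independent half-normal `Z₁, …, Z_N`. -/
def meanGaussQ (N : ℕ) (ρ : ℝ) : ℝ :=
  ∫ z, gaussQ (Real.sqrt ρ * (∑ i, z i) / Real.sqrt N) ∂Measure.pi fun _ : Fin N => halfNormal

lemma integrable_gaussQ_comp {α : Type*} [MeasurableSpace α] (m : Measure α)
    [IsFiniteMeasure m] {f : α → ℝ} (hf : AEMeasurable f m) :
    Integrable (fun x => gaussQ (f x)) m :=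
  Integrable.of_bound (measurable_gaussQ.comp_aemeasurable hf).aestronglyMeasurable 1
    (ae_of_all _ fun x => by
      rw [Real.norm_of_nonneg (gaussQ_nonneg _)]; exact gaussQ_le_one _)

lemma meanGaussQ_nonneg (N : ℕ) (ρ : ℝ) : 0 ≤ meanGaussQ N ρ :=
  integral_nonneg fun _ => gaussQ_nonneg _

/-- Conditionally on the half-normal parts `z`, the event says that an `N(0, N)` variable is at most
`-√ρ ∑ zᵢ`; integrating its `Q`-function tail over `z` gives the mean. -/
lemma measure_sum_alignedGain_nonpos {ρ : ℝ} (hρ : 0 < ρ) {N : ℕ} (hN : N ≠ 0) :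
    (Measure.pi fun _ : Fin N => alignedGainLaw ρ) {a | ∑ i, a i ≤ 0} =
      ENNReal.ofReal (meanGaussQ N ρ) := by
  have hmp := measurePreserving_alignedGainLaw_pi hρ N
  have hset : MeasurableSet {a : Fin N → ℝ | ∑ i, a i ≤ 0} :=
    measurableSet_le (by fun_prop) measurable_const
  have hc : 0 < Real.sqrt 2 * Real.sqrt (1 + ρ) := by positivity
  rw [← hmp.measure_preimage hset.nullMeasurableSet, Measure.prod_apply (hmp.measurable hset),
    meanGaussQ, ofReal_integral_eq_lintegral_ofReal
      (integrable_gaussQ_comp _ (by fun_prop)) (ae_of_all _ fun _ => gaussQ_nonneg _)]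
  refine lintegral_congr fun z => ?_
  have hs := map_sum_pi_gaussianReal N 1
  rw [mul_one] at hs
  rw [← gaussianReal_Iic_neg hN, ← hs, Measure.map_apply (by fun_prop) measurableSet_Iic]
  congr 1
  ext e
  simp only [Set.mem_preimage, Set.mem_ofPred_eq, Set.mem_Iic, ← Finset.sum_div,
    Finset.sum_add_distrib, ← Finset.mul_sum]
  rw [div_le_iff₀ hc, zero_mul]
  constructor <;> intro h <;> linarith

lemma ae_sum_alignedGain_ne_zero {ρ : ℝ} (hρ : 0 < ρ) {N : ℕ} (hN : N ≠ 0) :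
    ∀ᵐ a ∂(Measure.pi fun _ : Fin N => alignedGainLaw ρ), ∑ i, a i ≠ 0 := by
  have hmp := measurePreserving_alignedGainLaw_pi hρ N
  have hset : MeasurableSet {a : Fin N → ℝ | ∑ i, a i = 0} :=
    measurableSet_eq_fun (by fun_prop) measurable_const
  have hc : Real.sqrt 2 * Real.sqrt (1 + ρ) ≠ 0 := by positivity
  rw [ae_iff]
  simp only [not_not]
  rw [← hmp.measure_preimage hset.nullMeasurableSet, Measure.prod_apply (hmp.measurable hset),
    lintegral_eq_zero_iff (measurable_measure_prodMk_left (hmp.measurable hset))]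
  refine ae_of_all _ fun z => ?_
  have hs := map_sum_pi_gaussianReal N 1
  rw [mul_one] at hs
  have h0 : gaussianReal 0 (N : NNReal) {-(Real.sqrt ρ * ∑ i, z i)} = 0 :=
    gaussianReal_singleton (by exact_mod_cast hN) _
  rw [← hs, Measure.map_apply (by fun_prop) (measurableSet_singleton _)] at h0
  refine Eq.trans (congrArg _ ?_) h0
  ext e
  simp only [Set.mem_preimage, Set.mem_ofPred_eq, Set.mem_singleton_iff, ← Finset.sum_div,
    Finset.sum_add_distrib, ← Finset.mul_sum]
  rw [div_eq_zero_iff, or_iff_left hc]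
  constructor <;> intro h <;> linarith

lemma measure_sum_alignedGain_pos {ρ : ℝ} (hρ : 0 < ρ) {N : ℕ} (hN : N ≠ 0) :
    (Measure.pi fun _ : Fin N => alignedGainLaw ρ).real {a | 0 < ∑ i, a i} =
      1 - meanGaussQ N ρ := by
  have hset : MeasurableSet {a : Fin N → ℝ | ∑ i, a i ≤ 0} :=
    measurableSet_le (by fun_prop) measurable_const
  have : {a : Fin N → ℝ | 0 < ∑ i, a i} = {a | ∑ i, a i ≤ 0}ᶜ := by
    ext a; simp
  have hreal : (Measure.pi fun _ : Fin N => alignedGainLaw ρ).real {a | ∑ i, a i ≤ 0} =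
      meanGaussQ N ρ := by
    rw [measureReal_def, measure_sum_alignedGain_nonpos hρ hN,
      ENNReal.toReal_ofReal (meanGaussQ_nonneg N ρ)]
  rw [this, measureReal_compl hset, hreal]
  simp

/-! ### Maximum ratio combining in real coordinates -/

lemma measurePreserving_prod_middle {α β γ δ : Type*} [MeasurableSpace α] [MeasurableSpace β]
    [MeasurableSpace γ] [MeasurableSpace δ] (m₁ : Measure α) (m₂ : Measure β) (m₃ : Measure γ)
    (m₄ : Measure δ) [IsProbabilityMeasure m₁] [IsProbabilityMeasure m₂]
    [IsProbabilityMeasure m₃] [IsProbabilityMeasure m₄] :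
    MeasurePreserving (fun z : (α × β) × (γ × δ) => ((z.1.1, z.2.1), (z.1.2, z.2.2)))
      ((m₁.prod m₂).prod (m₃.prod m₄)) ((m₁.prod m₃).prod (m₂.prod m₄)) := by
  have h1 := measurePreserving_prodAssoc m₁ m₂ (m₃.prod m₄)
  have h2 := (MeasurePreserving.id m₁).prod (measurePreserving_prodAssoc m₂ m₃ m₄).symm
  have h3 := (MeasurePreserving.id m₁).prod
    ((Measure.measurePreserving_swap (μ := m₂) (ν := m₃)).prod (MeasurePreserving.id m₄))
  have h4 := (MeasurePreserving.id m₁).prod (measurePreserving_prodAssoc m₃ m₂ m₄)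
  have h5 := (measurePreserving_prodAssoc m₁ m₃ (m₂.prod m₄)).symm
  exact h5.comp (h4.comp (h3.comp (h2.comp h1)))

/-- The two aligned gains that one antenna contributes to the decision on the symbol `s`. -/
def branchGains (ρ : ℝ) (s : ℂ) (z : ℂ × ℂ) : ℝ × ℝ :=
  signedSwap (positiveOutput ρ) (alignedGain ρ)
    (((z.1 * s).re, z.2.re), ((z.1 * s).im, z.2.im))

lemma measurePreserving_mul_symbol {s : ℂ} (hs : s ∈ pskConstellation 4) :
    MeasurePreserving (fun z : ℂ => ((z * s).re, (z * s).im)) complexGaussian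
      ((gaussianReal 0 (1 / 2)).prod (gaussianReal 0 (1 / 2))) := by
  obtain ⟨a, b, ha, hb, rfl⟩ := mem_pskConstellation_four.1 hs
  have hab : (a / Real.sqrt 2) ^ 2 + (b / Real.sqrt 2) ^ 2 = 1 := by
    rw [div_pow, div_pow, Real.sq_sqrt (by norm_num)]
    rcases ha with rfl | rfl <;> rcases hb with rfl | rfl <;> norm_num
  convert (measurePreserving_rotation (1 / 2) hab).comp measurePreserving_re_im using 1
  funext z
  simp only [Function.comp, Complex.mul_re, Complex.mul_im, qpskPoint]
  ext <;> simp <;> ring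

lemma measurePreserving_outputComponents {s : ℂ} (hs : s ∈ pskConstellation 4) :
    MeasurePreserving (fun z : ℂ × ℂ => (((z.1 * s).re, z.2.re), ((z.1 * s).im, z.2.im)))
      (complexGaussian.prod complexGaussian)
      (((gaussianReal 0 (1 / 2)).prod (gaussianReal 0 (1 / 2))).prod
        ((gaussianReal 0 (1 / 2)).prod (gaussianReal 0 (1 / 2)))) :=
  (measurePreserving_prod_middle _ _ _ _).comp
    ((measurePreserving_mul_symbol hs).prod measurePreserving_re_im)

/-- Rotation by `s` leaves two independent quadrature axes, and the sign-dependent exchange keeps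
their gains i.i.d.; the law does not depend on `s`. -/
lemma measurePreserving_branchGains {ρ : ℝ} (hρ : 0 < ρ) {s : ℂ}
    (hs : s ∈ pskConstellation 4) :
    MeasurePreserving (branchGains ρ s) (complexGaussian.prod complexGaussian)
      ((alignedGainLaw ρ).prod (alignedGainLaw ρ)) :=
  (measurePreserving_signedSwap _ (measurableSet_positiveOutput ρ) (measurable_alignedGain ρ)
    fun _ hT => measure_positiveOutput_inter hρ hT).comp (measurePreserving_outputComponents hs)

/-- The vectors of aligned gains of all antennas. -/
def gainVectors {N : ℕ} (ρ : ℝ) (s : ℂ) (z : (Fin N → ℂ) × (Fin N → ℂ)) :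
    (Fin N → ℝ) × (Fin N → ℝ) :=
  (fun i => (branchGains ρ s (z.1 i, z.2 i)).1, fun i => (branchGains ρ s (z.1 i, z.2 i)).2)

lemma measurePreserving_gainVectors {ρ : ℝ} (hρ : 0 < ρ) (N : ℕ) {s : ℂ}
    (hs : s ∈ pskConstellation 4) :
    MeasurePreserving (gainVectors ρ s) ((complexGaussianVec N).prod (complexGaussianVec N))
      ((Measure.pi fun _ => alignedGainLaw ρ).prod (Measure.pi fun _ => alignedGainLaw ρ)) :=
  ((measurePreserving_arrowProdEquivProdArrow ℝ ℝ (Fin N) (fun _ => alignedGainLaw ρ)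
      (fun _ => alignedGainLaw ρ)).comp
    (measurePreserving_pi (fun _ : Fin N => complexGaussian.prod complexGaussian) _
      fun _ => measurePreserving_branchGains hρ hs)).comp
    (measurePreserving_arrowProdEquivProdArrow ℂ ℂ (Fin N) (fun _ => complexGaussian)
      (fun _ => complexGaussian)).symm

/-- All antenna outputs lie off the coordinate axes. -/
lemma ae_received_ne_zero {ρ : ℝ} (hρ : 0 < ρ) (N : ℕ) {s : ℂ} (hs : s ∈ pskConstellation 4) :
    ∀ᵐ z ∂(complexGaussianVec N).prod (complexGaussianVec N), ∀ i,
      Real.sqrt ρ * (z.1 i * s).re + (z.2 i).re ≠ 0 ∧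
      Real.sqrt ρ * (z.1 i * s).im + (z.2 i).im ≠ 0 := by
  rw [ae_all_iff]
  intro i
  have hi : MeasurePreserving (fun z : (Fin N → ℂ) × (Fin N → ℂ) => (z.1 i, z.2 i))
      ((complexGaussianVec N).prod (complexGaussianVec N))
      (complexGaussian.prod complexGaussian) :=
    (measurePreserving_eval (fun _ : Fin N => complexGaussian) i).prod
      (measurePreserving_eval (fun _ : Fin N => complexGaussian) i)
  have hc := (measurePreserving_outputComponents hs).comp hi
  have h1 := (measurePreserving_fst.comp hc).quasiMeasurePreserving.ae (ae_output_ne_zero hρ)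
  have h2 := (measurePreserving_snd.comp hc).quasiMeasurePreserving.ae (ae_output_ne_zero hρ)
  filter_upwards [h1, h2] with z hz hz'
  exact ⟨hz, hz'⟩

/-- Contribution of one antenna to the combiner output, with received signs `ε, δ`, against the
transmit symbol `(a + bj)/√2`. -/
lemma combiner_term {ρ : ℝ} {a b : ℝ} (ha : a = 1 ∨ a = -1) (hb : b = 1 ∨ b = -1) (h w : ℂ) :
    let s := qpskPoint a b
    let r := qpskPoint (sgn (Real.sqrt ρ * (h * s).re + w.re))
      (sgn (Real.sqrt ρ * (h * s).im + w.im))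
    (a * (starRingEnd ℂ h * r).re, b * (starRingEnd ℂ h * r).im) =
      if a = b then branchGains ρ s (h, w) else (branchGains ρ s (h, w)).swap := by
  intro s r
  have h2 : Real.sqrt 2 ^ 2 = 2 := Real.sq_sqrt (by norm_num)
  have h0 : Real.sqrt 2 ≠ 0 := by positivity
  have hre : (h * s).re = (a * h.re - b * h.im) / Real.sqrt 2 := by
    simp only [s, qpskPoint, Complex.mul_re]; ring
  have him : (h * s).im = (b * h.re + a * h.im) / Real.sqrt 2 := by
    simp only [s, qpskPoint, Complex.mul_im]; ring
  unfold branchGains signedSwap alignedGain positiveOutput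
  simp only [Set.mem_ofPred_eq, Complex.mul_re, Complex.mul_im, Complex.conj_re, Complex.conj_im, r]
  -- The expansion also reached the output components inside the signs; they are folded back so that
  -- they can be generalised.
  simp only [← Complex.mul_re, ← Complex.mul_im]
  generalize hp : Real.sqrt ρ * (h * s).re + w.re = p
  generalize hq : Real.sqrt ρ * (h * s).im + w.im = q
  rw [hre, him]
  unfold sgn qpskPoint
  rcases ha with rfl | rfl <;> rcases hb with rfl | rfl <;>
    rcases lt_or_ge 0 p with h | h <;> rcases lt_or_ge 0 q with h' | h' <;>
    simp only [h, h', h.not_gt, h'.not_gt, if_true, if_false, iff_self, iff_true, iff_false,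
      not_true, Prod.swap_prod_mk] <;>
    norm_num <;> constructor <;> ring

/-- Off the decision boundaries, the symbol is detected correctly exactly when both sums of aligned
gains are positive. -/
lemma mrcDetect_eq_iff {Q : ℂ → ℂ} (hQ : IsPhaseQuantizer 2 Q) {N : ℕ} {ρ : ℝ} {s : ℂ}
    (hs : s ∈ pskConstellation 4) {h w : Fin N → ℂ}
    (hy : ∀ i, Real.sqrt ρ * (h i * s).re + (w i).re ≠ 0 ∧
      Real.sqrt ρ * (h i * s).im + (w i).im ≠ 0)
    (hA : ∑ i, (gainVectors ρ s (h, w)).1 i ≠ 0) (hB : ∑ i, (gainVectors ρ s (h, w)).2 i ≠ 0) :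
    mrcDetect Q Q ρ s h w = s ↔
      0 < ∑ i, (gainVectors ρ s (h, w)).1 i ∧ 0 < ∑ i, (gainVectors ρ s (h, w)).2 i := by
  obtain ⟨a, b, ha, hb, rfl⟩ := mem_pskConstellation_four.1 hs
  set s := qpskPoint a b with hsdef
  have hrec (i : Fin N) : Q (received ρ s h w i) =
      qpskPoint (sgn (Real.sqrt ρ * (h i * s).re + (w i).re))
        (sgn (Real.sqrt ρ * (h i * s).im + (w i).im)) := by
    have hre : (received ρ s h w i).re = Real.sqrt ρ * (h i * s).re + (w i).re := by
      rw [received, mul_assoc, Complex.add_re, Complex.re_ofReal_mul]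
    have him : (received ρ s h w i).im = Real.sqrt ρ * (h i * s).im + (w i).im := by
      rw [received, mul_assoc, Complex.add_im, Complex.im_ofReal_mul]
    rw [hQ.apply_eq (by rw [hre]; exact (hy i).1) (by rw [him]; exact (hy i).2), hre, him]
  have hterm (i : Fin N) := combiner_term (ρ := ρ) ha hb (h i) (w i)
  simp only [← hsdef, ← hrec] at hterm
  unfold mrcDetect
  set V := ∑ i, starRingEnd ℂ (h i) * Q (received ρ s h w i) with hV
  have hVre : a * V.re = ∑ i, a * (starRingEnd ℂ (h i) * Q (received ρ s h w i)).re := by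
    rw [hV, Complex.re_sum, Finset.mul_sum]
  have hVim : b * V.im = ∑ i, b * (starRingEnd ℂ (h i) * Q (received ρ s h w i)).im := by
    rw [hV, Complex.im_sum, Finset.mul_sum]
  have hpair : (a * V.re, b * V.im) = if a = b then
      (∑ i, (gainVectors ρ s (h, w)).1 i, ∑ i, (gainVectors ρ s (h, w)).2 i) else
      (∑ i, (gainVectors ρ s (h, w)).2 i, ∑ i, (gainVectors ρ s (h, w)).1 i) := by
    rw [hVre, hVim]
    split_ifs with hab
    · simp only [if_pos hab] at hterm
      simp only [gainVectors, ← hterm]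
    · simp only [if_neg hab] at hterm
      have hterm' (i : Fin N) := congrArg Prod.swap (hterm i)
      simp only [Prod.swap_swap] at hterm'
      simp only [gainVectors, ← hterm', Prod.swap_prod_mk]
  -- Whether `a = b` only decides the order of the two sums, to which the joint positivity condition
  -- is indifferent.
  have hor : (a * V.re = ∑ i, (gainVectors ρ s (h, w)).1 i ∧
        b * V.im = ∑ i, (gainVectors ρ s (h, w)).2 i) ∨
      (a * V.re = ∑ i, (gainVectors ρ s (h, w)).2 i ∧
        b * V.im = ∑ i, (gainVectors ρ s (h, w)).1 i) := by
    split_ifs at hpair with hab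
    · exact Or.inl (Prod.ext_iff.1 hpair)
    · exact Or.inr (Prod.ext_iff.1 hpair)
  rcases hor with ⟨h1, h2⟩ | ⟨h1, h2⟩
  · rw [hsdef, hQ.apply_eq_iff (right_ne_zero_of_mul (h1 ▸ hA)) (right_ne_zero_of_mul (h2 ▸ hB))
      ha hb, h1, h2]
  · rw [hsdef, hQ.apply_eq_iff (right_ne_zero_of_mul (h1 ▸ hB)) (right_ne_zero_of_mul (h2 ▸ hA))
      ha hb, h1, h2, and_comm]

/-! ### The symbol error probability -/

/-- The event, in terms of symbol, channel and noise, that both sums of aligned gains are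
positive. -/
def correctSet (N : ℕ) (ρ : ℝ) : Set (ℂ × (Fin N → ℂ) × (Fin N → ℂ)) :=
  {z | 0 < ∑ i, (gainVectors ρ z.1 z.2).1 i ∧ 0 < ∑ i, (gainVectors ρ z.1 z.2).2 i}

lemma measurableSet_correctSet (N : ℕ) (ρ : ℝ) : MeasurableSet (correctSet N ρ) := by
  have hK := measurable_signedSwap (measurableSet_positiveOutput ρ) (measurable_alignedGain ρ)
  have hb (i : Fin N) : Measurable fun z : ℂ × (Fin N → ℂ) × (Fin N → ℂ) =>
      branchGains ρ z.1 (z.2.1 i, z.2.2 i) := by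
    refine hK.comp (Measurable.prodMk (Measurable.prodMk ?_ ?_) (Measurable.prodMk ?_ ?_)) <;>
    fun_prop
  exact (measurableSet_lt measurable_const
    (Finset.measurable_sum _ fun i _ => (hb i).fst)).inter (measurableSet_lt measurable_const
    (Finset.measurable_sum _ fun i _ => (hb i).snd))

lemma measure_correctSet_section {ρ : ℝ} (hρ : 0 < ρ) {N : ℕ} (hN : N ≠ 0) {s : ℂ}
    (hs : s ∈ pskConstellation 4) :
    ((complexGaussianVec N).prod (complexGaussianVec N)) (Prod.mk s ⁻¹' correctSet N ρ) =
      ENNReal.ofReal ((1 - meanGaussQ N ρ) ^ 2) := by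
  have hset : MeasurableSet {a : Fin N → ℝ | 0 < ∑ i, a i} :=
    measurableSet_lt measurable_const (by fun_prop)
  have hpre : Prod.mk s ⁻¹' correctSet N ρ =
      gainVectors ρ s ⁻¹' ({a | 0 < ∑ i, a i} ×ˢ {a | 0 < ∑ i, a i}) := rfl
  rw [hpre, (measurePreserving_gainVectors hρ N hs).measure_preimage
    (hset.prod hset).nullMeasurableSet, Measure.prod_prod, ← measure_sum_alignedGain_pos hρ hN,
    sq, ENNReal.ofReal_mul measureReal_nonneg, ofReal_measureReal]

/-- For every fixed symbol the two decision sums are independent, each positive with probability `1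
- E`, so correct detection has probability `(1 - E)²` with no dependence on the symbol. -/
theorem averageSEP_eq {Ω : Type*} [MeasurableSpace Ω] (P : Measure Ω) [IsProbabilityMeasure P]
    {N : ℕ} (hN : N ≠ 0) {Q : ℂ → ℂ} (hQ : IsPhaseQuantizer 2 Q) {s : Ω → ℂ}
    {h w : Ω → Fin N → ℂ} (hsys : IsRayleighSIMO P 4 N s h w) {ρ : ℝ} (hρ : 0 < ρ) :
    averageSEP P Q Q s h w ρ = 2 * meanGaussQ N ρ - meanGaussQ N ρ ^ 2 := by
  have hchan : HasLaw (fun ω => (h ω, w ω))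
      ((complexGaussianVec N).prod (complexGaussianVec N)) P :=
    (indepFun_iff_hasLaw_prodMk_prod hsys.channel_law hsys.noise_law).1 hsys.indep_channel_noise
  have hchanFin : SFinite ((complexGaussianVec N).prod (complexGaussianVec N)) :=
    Measure.prod.instSFinite
  have hne : (pskConstellation 4).Nonempty :=
    ⟨_, mem_pskConstellation_four.2 ⟨1, 1, by simp, by simp, rfl⟩⟩
  have hprob := isProbabilityMeasure_uniformOn (finite_pskConstellation 4) hne
  have hjoint : HasLaw (fun ω => (s ω, (h ω, w ω))) ((uniformOn (pskConstellation 4)).prod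
      ((complexGaussianVec N).prod (complexGaussianVec N))) P :=
    (indepFun_iff_hasLaw_prodMk_prod hsys.symbol_law hchan).1 hsys.indep_symbol
  have hmem : ∀ᵐ s₀ ∂uniformOn (pskConstellation 4), s₀ ∈ pskConstellation 4 :=
    ae_cond_mem (finite_pskConstellation 4).measurableSet
  have hC := measurableSet_correctSet N ρ
  have hmeas : P {ω | (s ω, (h ω, w ω)) ∈ correctSet N ρ} =
      ENNReal.ofReal ((1 - meanGaussQ N ρ) ^ 2) := by
    rw [hjoint.measure_eq (p := fun z => z ∈ correctSet N ρ) hC]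
    change (Measure.prod _ _) (correctSet N ρ) = _
    rw [Measure.prod_apply hC, lintegral_congr_ae
      (g := fun _ => ENNReal.ofReal ((1 - meanGaussQ N ρ) ^ 2))]
    · simp
    · filter_upwards [hmem] with s₀ hs₀
      exact measure_correctSet_section hρ hN hs₀
  -- Exceptional null sets are found per fixed symbol; finiteness of the constellation merges them,
  -- which allows the random `s ω` to be substituted.
  have hgood : ∀ᵐ ω ∂P, ∀ s₀ ∈ pskConstellation 4, (mrcDetect Q Q ρ s₀ (h ω) (w ω) = s₀ ↔
      (s₀, (h ω, w ω)) ∈ correctSet N ρ) := by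
    rw [ae_ball_iff (finite_pskConstellation 4).countable]
    intro s₀ hs₀
    have hmp := measurePreserving_gainVectors hρ N hs₀
    have h1 := (measurePreserving_fst.comp hmp).quasiMeasurePreserving.ae
      (ae_sum_alignedGain_ne_zero hρ hN)
    have h2 := (measurePreserving_snd.comp hmp).quasiMeasurePreserving.ae
      (ae_sum_alignedGain_ne_zero hρ hN)
    have h3 : ∀ᵐ z ∂P.map (fun ω => (h ω, w ω)),
        (mrcDetect Q Q ρ s₀ z.1 z.2 = s₀ ↔ (s₀, z) ∈ correctSet N ρ) := by
      rw [hchan.map_eq]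
      filter_upwards [h1, h2, ae_received_ne_zero hρ N hs₀] with z hz1 hz2 hz3
      exact mrcDetect_eq_iff hQ hs₀ hz3 hz1 hz2
    exact ae_of_ae_map hchan.aemeasurable h3
  have hsmem : ∀ᵐ ω ∂P, s ω ∈ pskConstellation 4 := by
    rw [← hsys.symbol_law.map_eq] at hmem
    exact ae_of_ae_map hsys.symbol_law.aemeasurable hmem
  have hnull : NullMeasurableSet {ω | (s ω, (h ω, w ω)) ∈ correctSet N ρ} P :=
    hjoint.aemeasurable.nullMeasurable hC
  have herr : P.real {ω | mrcDetect Q Q ρ (s ω) (h ω) (w ω) ≠ s ω} =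
      P.real {ω | (s ω, (h ω, w ω)) ∈ correctSet N ρ}ᶜ := by
    refine measureReal_congr (eventuallyEq_set.2 ?_)
    filter_upwards [hgood, hsmem] with ω hω hω'
    exact not_congr (hω _ hω')
  have hreal : P.real {ω | (s ω, (h ω, w ω)) ∈ correctSet N ρ} = (1 - meanGaussQ N ρ) ^ 2 := by
    rw [measureReal_def, hmeas, ENNReal.toReal_ofReal (sq_nonneg _)]
  rw [averageSEP, herr, measureReal_compl₀ hnull, hreal]
  simp only [probReal_univ]
  ring

/-- The average over the channel of `Q(√(ρU))` is `meanGaussQ`. -/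
lemma integral_gaussQ_statU {Ω : Type*} [MeasurableSpace Ω] {P : Measure Ω}
    [IsProbabilityMeasure P] {N : ℕ} {h : Ω → Fin N → ℂ}
    (hh : HasLaw h (complexGaussianVec N) P) {Q : ℂ → ℂ} (hQ : IsPhaseQuantizer 2 Q) {ρ : ℝ}
    (hρ : 0 < ρ) :
    ∫ ω, gaussQ (Real.sqrt (ρ * statU Q (h ω))) ∂P = meanGaussQ N ρ := by
  have hlaw := hasLaw_statZ_vec hh hQ
  have hnonneg : ∀ᵐ x ∂halfNormal, 0 ≤ x := by
    rw [← map_abs_gaussianReal, ae_map_iff (by fun_prop) measurableSet_Ici]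
    exact ae_of_all _ fun x => abs_nonneg x
  have hz : ∀ᵐ ω ∂P, ∀ i, 0 ≤ statZ Q (h ω i) := by
    rw [ae_all_iff]
    intro i
    have hi := hasLaw_statZ_comp hh hQ i
    rw [← hi.map_eq] at hnonneg
    exact ae_of_ae_map hi.aemeasurable hnonneg
  rw [meanGaussQ, ← hlaw.integral_comp
    (f := fun z => gaussQ (Real.sqrt ρ * (∑ i, z i) / Real.sqrt N))
    (measurable_gaussQ.comp (by fun_prop)).aestronglyMeasurable]
  refine integral_congr_ae ?_
  filter_upwards [hz] with ω hω
  -- Nonnegativity is what makes `√U` equal to `T` rather than `|T|`.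
  have hT : 0 ≤ statT Q (h ω) := mul_nonneg (by positivity) (Finset.sum_nonneg fun i _ => hω i)
  rw [statU, Real.sqrt_mul hρ.le, Real.sqrt_sq hT, statT, Function.comp]
  congr 1
  ring

/-! ### High-SNR asymptotics -/

lemma pi_gaussianReal_eq_withDensity (N : ℕ) :
    (Measure.pi fun _ : Fin N => gaussianReal 0 1) =
      volume.withDensity fun x => ENNReal.ofReal (∏ i, gaussianPDFReal 0 1 (x i)) := by
  symm
  refine (Measure.pi_eq fun s hs => ?_).symm
  rw [withDensity_apply _ (.univ_pi hs), ← lintegral_indicator (.univ_pi hs)]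
  have hi (i : Fin N) : Integrable ((s i).indicator (gaussianPDFReal 0 1)) :=
    (integrable_gaussianPDFReal 0 1).indicator (hs i)
  have hnn (i : Fin N) (x : ℝ) : 0 ≤ (s i).indicator (gaussianPDFReal 0 1) x :=
    Set.indicator_nonneg (fun _ _ => gaussianPDFReal_nonneg _ _ _) _
  have hprod := integral_fintype_prod_volume_eq_prod (E := fun _ : Fin N => ℝ)
    fun i => (s i).indicator (gaussianPDFReal 0 1)
  have hfun (x : Fin N → ℝ) : (Set.univ.pi s).indicator
      (fun x => ENNReal.ofReal (∏ i, gaussianPDFReal 0 1 (x i))) x =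
      ENNReal.ofReal (∏ i, (s i).indicator (gaussianPDFReal 0 1) (x i)) := by
    by_cases hx : x ∈ Set.univ.pi s
    · rw [Set.indicator_of_mem hx]
      congr 1
      exact Finset.prod_congr rfl fun i _ => (Set.indicator_of_mem (hx i trivial) _).symm
    · rw [Set.indicator_of_notMem hx]
      simp only [Set.mem_pi, Set.mem_univ, forall_true_left, not_forall] at hx
      obtain ⟨i, hi⟩ := hx
      rw [Finset.prod_eq_zero (Finset.mem_univ i) (Set.indicator_of_notMem hi _),
        ENNReal.ofReal_zero]
  simp_rw [hfun]
  have hint : Integrable (fun x : Fin N → ℝ => ∏ i, (s i).indicator (gaussianPDFReal 0 1) (x i)) :=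
    Integrable.fintype_prod hi
  rw [← ofReal_integral_eq_lintegral_ofReal hint
    (ae_of_all _ fun x => Finset.prod_nonneg fun i _ => hnn i _), hprod,
    ENNReal.ofReal_prod_of_nonneg fun i _ => integral_nonneg (hnn i)]
  refine Finset.prod_congr rfl fun i _ => ?_
  rw [integral_indicator (hs i), gaussianReal_apply_eq_integral 0 one_ne_zero]

lemma volume_sum_abs_lt {N : ℕ} (hN : N ≠ 0) (r : ℝ) :
    volume {x : Fin N → ℝ | ∑ i, |x i| < r} =
      ENNReal.ofReal r ^ N * ENNReal.ofReal (2 ^ N / N.factorial) := by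
  have : NeZero N := ⟨hN⟩
  have h := volume_sum_rpow_lt (Fin N) (p := 1) le_rfl r
  simpa [Real.Gamma_nat_eq_factorial, Real.Gamma_two, one_add_one_eq_two] using h

/-- The probability that the absolute values of `N` independent standard normal variables add up to
less than `r`. -/
def sumAbsCDF (N : ℕ) (r : ℝ) : ℝ :=
  (Measure.pi fun _ : Fin N => gaussianReal 0 1).real {x | ∑ i, |x i| < r}

lemma prod_gaussianPDFReal {N : ℕ} (x : Fin N → ℝ) :
    ∏ i, gaussianPDFReal 0 1 (x i) =
      (Real.sqrt (2 * Real.pi))⁻¹ ^ N * Real.exp (-(∑ i, x i ^ 2) / 2) := by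
  simp only [gaussianPDFReal, NNReal.coe_one, mul_one, sub_zero, Finset.prod_mul_distrib,
    Finset.prod_const, Finset.card_univ, Fintype.card_fin, ← Real.exp_sum]
  rw [← Finset.sum_div, Finset.sum_neg_distrib]

lemma measurableSet_sum_abs_lt (N : ℕ) (r : ℝ) :
    MeasurableSet {x : Fin N → ℝ | ∑ i, |x i| < r} :=
  measurableSet_lt (by fun_prop) measurable_const

/-- The constant in the small-ball asymptotics of `sumAbsCDF`. -/
def smallBallConst (N : ℕ) : ℝ := (Real.sqrt (2 * Real.pi))⁻¹ ^ N * (2 ^ N / N.factorial)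

lemma sumAbsCDF_of_nonpos (N : ℕ) {r : ℝ} (hr : r ≤ 0) : sumAbsCDF N r = 0 := by
  have : {x : Fin N → ℝ | ∑ i, |x i| < r} = ∅ := by
    ext x
    simpa using hr.trans (Finset.sum_nonneg fun i _ => abs_nonneg (x i))
  rw [sumAbsCDF, this, measureReal_empty]

lemma setLIntegral_const_sum_abs_lt {N : ℕ} (hN : N ≠ 0) {r c : ℝ} (hr : 0 ≤ r) (hc : 0 ≤ c) :
    ∫⁻ _ in {x : Fin N → ℝ | ∑ i, |x i| < r}, ENNReal.ofReal c =
      ENNReal.ofReal (c * (2 ^ N / N.factorial) * r ^ N) := by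
  rw [setLIntegral_const, volume_sum_abs_lt hN, ← ENNReal.ofReal_pow hr,
    ← ENNReal.ofReal_mul (by positivity), ← ENNReal.ofReal_mul hc]
  congr 1
  ring

/-- The Gaussian density is largest at the origin. The bound holds for all `r ≥ 0`, so it also
serves for domination. -/
lemma sumAbsCDF_le {N : ℕ} (hN : N ≠ 0) {r : ℝ} (hr : 0 ≤ r) :
    sumAbsCDF N r ≤ smallBallConst N * r ^ N := by
  have hS := measurableSet_sum_abs_lt N r
  have hK : 0 ≤ smallBallConst N * r ^ N := by unfold smallBallConst; positivity
  rw [sumAbsCDF, measureReal_def]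
  refine ENNReal.toReal_le_of_le_ofReal hK ?_
  rw [pi_gaussianReal_eq_withDensity, withDensity_apply _ hS, smallBallConst,
    ← setLIntegral_const_sum_abs_lt hN hr (by positivity)]
  refine setLIntegral_mono' hS fun x _ => ENNReal.ofReal_le_ofReal ?_
  rw [prod_gaussianPDFReal]
  refine mul_le_of_le_one_right (by positivity) (Real.exp_le_one_iff.2 ?_)
  have : 0 ≤ ∑ i, x i ^ 2 := Finset.sum_nonneg fun i _ => sq_nonneg _
  linarith

/-- The ℓ¹ ball of radius `r` lies in the Euclidean one, so there the density loses at most the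
factor `exp (-r² / 2)`. -/
lemma le_sumAbsCDF {N : ℕ} (hN : N ≠ 0) {r : ℝ} (hr : 0 ≤ r) :
    smallBallConst N * r ^ N * Real.exp (-r ^ 2 / 2) ≤ sumAbsCDF N r := by
  have hS := measurableSet_sum_abs_lt N r
  rw [sumAbsCDF, measureReal_def, ← ENNReal.ofReal_le_iff_le_toReal (measure_ne_top _ _),
    pi_gaussianReal_eq_withDensity, withDensity_apply _ hS, smallBallConst]
  have : (Real.sqrt (2 * Real.pi))⁻¹ ^ N * (2 ^ N / N.factorial) * r ^ N * Real.exp (-r ^ 2 / 2) =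
      ((Real.sqrt (2 * Real.pi))⁻¹ ^ N * Real.exp (-r ^ 2 / 2)) * (2 ^ N / N.factorial) *
        r ^ N := by ring
  rw [this, ← setLIntegral_const_sum_abs_lt hN hr (by positivity)]
  refine setLIntegral_mono' hS fun x hx => ENNReal.ofReal_le_ofReal ?_
  rw [prod_gaussianPDFReal]
  refine mul_le_mul_of_nonneg_left (Real.exp_le_exp.2 ?_) (by positivity)
  have hx : ∑ i, |x i| < r := hx
  have h1 : ∑ i, x i ^ 2 ≤ (∑ i, |x i|) ^ 2 := by
    simpa using Finset.sum_sq_le_sq_sum_of_nonneg (s := Finset.univ) (f := fun i => |x i|)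
      fun i _ => abs_nonneg _
  have h2 : (∑ i, |x i|) ^ 2 ≤ r ^ 2 :=
    pow_le_pow_left₀ (Finset.sum_nonneg fun i _ => abs_nonneg _) hx.le 2
  linarith

lemma measure_pi_halfNormal_sum_lt (N : ℕ) (r : ℝ) :
    (Measure.pi fun _ : Fin N => halfNormal) {z | ∑ i, z i < r} =
      ENNReal.ofReal (sumAbsCDF N r) := by
  have h : MeasurePreserving (fun x : ℝ => |x|) (gaussianReal 0 1) halfNormal :=
    ⟨by fun_prop, map_abs_gaussianReal⟩
  rw [sumAbsCDF, ofReal_measureReal, ← (measurePreserving_pi (fun _ : Fin N => gaussianReal 0 1) _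
    fun _ => h).measure_preimage
      (measurableSet_lt (by fun_prop) measurable_const).nullMeasurableSet]
  rfl

lemma monotone_sumAbsCDF (N : ℕ) : Monotone (sumAbsCDF N) := fun _ _ hab =>
  measureReal_mono fun _ hx => lt_of_lt_of_le hx hab

lemma sumAbsCDF_nonneg (N : ℕ) (r : ℝ) : 0 ≤ sumAbsCDF N r := measureReal_nonneg

lemma sumAbsCDF_le_one (N : ℕ) (r : ℝ) : sumAbsCDF N r ≤ 1 := measureReal_le_one

/-- Exchanging the roles of the two independent parts in the average of the `Q`-function. -/
lemma meanGaussQ_eq_integral_sumAbsCDF {N : ℕ} (hN : N ≠ 0) {ρ : ℝ} (hρ : 0 < ρ) :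
    meanGaussQ N ρ =
      ∫ g, sumAbsCDF N (Real.sqrt N * g / Real.sqrt ρ) ∂gaussianReal 0 1 := by
  have hN0 : 0 < Real.sqrt N := Real.sqrt_pos.2 (by positivity)
  have hρ0 : 0 < Real.sqrt ρ := Real.sqrt_pos.2 hρ
  have hS : MeasurableSet {p : (Fin N → ℝ) × ℝ |
      Real.sqrt ρ * (∑ i, p.1 i) / Real.sqrt N < p.2} :=
    measurableSet_lt (by fun_prop) measurable_snd
  have hint : Integrable (fun g => sumAbsCDF N (Real.sqrt N * g / Real.sqrt ρ))
      (gaussianReal 0 1) :=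
    Integrable.of_bound ((monotone_sumAbsCDF N).measurable.comp (by fun_prop)).aestronglyMeasurable
      1 (ae_of_all _ fun x => by
        rw [Real.norm_of_nonneg (sumAbsCDF_nonneg _ _)]; exact sumAbsCDF_le_one _ _)
  rw [← ENNReal.ofReal_eq_ofReal_iff (meanGaussQ_nonneg N ρ)
    (integral_nonneg fun _ => sumAbsCDF_nonneg _ _),
    ofReal_integral_eq_lintegral_ofReal hint (ae_of_all _ fun _ => sumAbsCDF_nonneg _ _),
    meanGaussQ, ofReal_integral_eq_lintegral_ofReal
      (integrable_gaussQ_comp _ (by fun_prop)) (ae_of_all _ fun _ => gaussQ_nonneg _)]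
  simp_rw [ofReal_gaussQ, ← measure_pi_halfNormal_sum_lt]
  -- Tonelli: both sides are the product measure of the single set `hS`, sliced in the two
  -- directions.
  refine Eq.trans (Measure.prod_apply hS).symm ((Measure.prod_apply_symm hS).trans ?_)
  refine lintegral_congr fun g => congrArg _ ?_
  ext z
  simp only [Set.mem_preimage, Set.mem_ofPred_eq]
  rw [div_lt_iff₀ hN0, lt_div_iff₀ hρ0, mul_comm (Real.sqrt ρ), mul_comm g]

/-- The limit of `ρ^{N/2} 𝔼[Q(√ρ T)]`. -/
def meanGaussQLimit (N : ℕ) : ℝ :=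
  ∫ g, (if 0 < g then smallBallConst N * (Real.sqrt N * g) ^ N else 0) ∂gaussianReal 0 1

/-- The factor `√ρ ^ N` cancels the scale in the small-ball bounds. The upper one gives a multiple
of `|g| ^ N` as integrable majorant, and both squeeze the integrand pointwise. -/
lemma tendsto_meanGaussQ {N : ℕ} (hN : N ≠ 0) :
    Tendsto (fun ρ : ℝ => Real.sqrt ρ ^ N * meanGaussQ N ρ) atTop (nhds (meanGaussQLimit N)) := by
  have hK : 0 ≤ smallBallConst N := by unfold smallBallConst; positivity
  have hlim : Tendsto (fun ρ : ℝ => ∫ g, Real.sqrt ρ ^ N *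
      sumAbsCDF N (Real.sqrt N * g / Real.sqrt ρ) ∂gaussianReal 0 1) atTop
      (nhds (meanGaussQLimit N)) := by
    refine tendsto_integral_filter_of_dominated_convergence
      (fun g => smallBallConst N * (Real.sqrt N) ^ N * |g ^ N|) ?_ ?_ ?_ ?_
    · exact Eventually.of_forall fun ρ => (measurable_const.mul
        ((monotone_sumAbsCDF N).measurable.comp (by fun_prop))).aestronglyMeasurable
    · filter_upwards [eventually_gt_atTop 0] with ρ hρ
      have hρ0 : 0 < Real.sqrt ρ := Real.sqrt_pos.2 hρ
      refine ae_of_all _ fun g => ?_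
      rw [Real.norm_of_nonneg (mul_nonneg (by positivity) (sumAbsCDF_nonneg _ _))]
      rcases le_or_gt g 0 with hg | hg
      · rw [sumAbsCDF_of_nonpos, mul_zero]
        · positivity
        · exact div_nonpos_of_nonpos_of_nonneg
            (mul_nonpos_of_nonneg_of_nonpos (Real.sqrt_nonneg _) hg) hρ0.le
      · refine (mul_le_mul_of_nonneg_left (sumAbsCDF_le hN (by positivity))
          (by positivity)).trans_eq ?_
        rw [abs_of_pos (by positivity), div_pow, mul_pow]
        field_simp
    · have : Integrable (fun g : ℝ => g ^ N) (gaussianReal 0 1) := by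
        have := (memLp_id_gaussianReal (μ := 0) (v := 1) N).integrable_norm_pow hN
        refine (integrable_norm_iff (by fun_prop)).1 ?_
        simpa using this
      exact this.abs.const_mul _
    · refine ae_of_all _ fun g => ?_
      split_ifs with hg
      · have hexp : Tendsto (fun ρ : ℝ => smallBallConst N * (Real.sqrt N * g) ^ N *
            Real.exp (-(Real.sqrt N * g) ^ 2 / 2 * ρ⁻¹)) atTop
            (nhds (smallBallConst N * (Real.sqrt N * g) ^ N)) := by
          have h1 : Tendsto (fun ρ : ℝ => -(Real.sqrt N * g) ^ 2 / 2 * ρ⁻¹) atTop (nhds 0) := by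
            simpa using (tendsto_inv_atTop_zero (𝕜 := ℝ)).const_mul (-(Real.sqrt N * g) ^ 2 / 2)
          simpa using ((Real.continuous_exp.tendsto 0).comp h1).const_mul
            (smallBallConst N * (Real.sqrt N * g) ^ N)
        refine tendsto_of_tendsto_of_tendsto_of_le_of_le' hexp tendsto_const_nhds ?_ ?_
        · filter_upwards [eventually_gt_atTop 0] with ρ hρ
          have hρ0 : 0 < Real.sqrt ρ := Real.sqrt_pos.2 hρ
          refine Eq.trans_le ?_ (mul_le_mul_of_nonneg_left
            (le_sumAbsCDF hN (by positivity : 0 ≤ Real.sqrt N * g / Real.sqrt ρ)) (by positivity))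
          have : -(Real.sqrt N * g) ^ 2 / 2 * ρ⁻¹ = -(Real.sqrt N * g / Real.sqrt ρ) ^ 2 / 2 := by
            rw [div_pow, Real.sq_sqrt hρ.le]
            field_simp
          rw [this, div_pow _ _ N]
          field_simp
        · filter_upwards [eventually_gt_atTop 0] with ρ hρ
          have hρ0 : 0 < Real.sqrt ρ := Real.sqrt_pos.2 hρ
          refine (mul_le_mul_of_nonneg_left (sumAbsCDF_le hN (by positivity))
            (by positivity)).trans_eq ?_
          rw [div_pow]
          field_simp
      · refine tendsto_const_nhds.congr fun ρ => ?_
        rw [sumAbsCDF_of_nonpos, mul_zero]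
        exact div_nonpos_of_nonpos_of_nonneg
          (mul_nonpos_of_nonneg_of_nonpos (Real.sqrt_nonneg _) (not_lt.1 hg)) (Real.sqrt_nonneg _)
  refine hlim.congr' ?_
  filter_upwards [eventually_gt_atTop 0] with ρ hρ
  rw [integral_const_mul, meanGaussQ_eq_integral_sumAbsCDF hN hρ]

/-- The high-SNR constant `(1/N!) 2^N π^{-(N+1)/2} N^{N/2} Γ((N+1)/2)`. -/
def sepConst (N : ℕ) : ℝ :=
  1 / (Nat.factorial N : ℝ) * (2 : ℝ) ^ N * Real.pi ^ (-(((N : ℝ) + 1) / 2)) *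
    (N : ℝ) ^ ((N : ℝ) / 2) * Real.Gamma (((N : ℝ) + 1) / 2)

lemma sqrt_pow_eq_rpow {x : ℝ} (hx : 0 ≤ x) (N : ℕ) : Real.sqrt x ^ N = x ^ ((N : ℝ) / 2) := by
  rw [Real.sqrt_eq_rpow, ← Real.rpow_natCast, ← Real.rpow_mul hx]
  congr 1
  ring

lemma two_mul_meanGaussQLimit (N : ℕ) : 2 * meanGaussQLimit N = sepConst N := by
  -- The half-line Gaussian moment of order `N`, source of the factor `Γ((N + 1) / 2)`.
  have hI : ∫ g in Set.Ioi (0 : ℝ), g ^ (N : ℝ) * Real.exp (-(1 / 2) * g ^ (2 : ℝ)) =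
      (1 / 2 : ℝ) ^ (-((N : ℝ) + 1) / 2) * (1 / 2) * Real.Gamma (((N : ℝ) + 1) / 2) :=
    integral_rpow_mul_exp_neg_mul_rpow (by norm_num) (by
      have : (0 : ℝ) ≤ N := Nat.cast_nonneg N
      linarith) (by norm_num)
  have h1 : meanGaussQLimit N = smallBallConst N * Real.sqrt N ^ N *
      (Real.sqrt (2 * Real.pi))⁻¹ *
      ∫ g in Set.Ioi (0 : ℝ), g ^ (N : ℝ) * Real.exp (-(1 / 2) * g ^ (2 : ℝ)) := by
    rw [meanGaussQLimit, integral_gaussianReal_eq_integral_smul one_ne_zero, ← integral_const_mul,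
      ← integral_indicator measurableSet_Ioi]
    refine integral_congr_ae (ae_of_all _ fun g => ?_)
    by_cases hg : 0 < g
    · simp only [Set.indicator, Set.mem_Ioi, hg, if_true, gaussianPDFReal, smul_eq_mul, mul_pow,
        Real.rpow_natCast, Real.rpow_two, NNReal.coe_one, mul_one, sub_zero]
      have : -(1 / 2) * g ^ 2 = -g ^ 2 / 2 := by ring
      rw [this]
      ring
    · simp [Set.indicator, hg]
  have h2 : (1 / 2 : ℝ) ^ (-((N : ℝ) + 1) / 2) = Real.sqrt 2 ^ (N + 1) := by
    rw [sqrt_pow_eq_rpow (by norm_num), one_div, Real.inv_rpow (by norm_num),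
      ← Real.rpow_neg (by norm_num)]
    congr 1
    push_cast
    ring
  have h3 : Real.pi ^ (-(((N : ℝ) + 1) / 2)) = (Real.sqrt Real.pi ^ (N + 1))⁻¹ := by
    rw [sqrt_pow_eq_rpow Real.pi_pos.le, Real.rpow_neg Real.pi_pos.le]
    push_cast
    rfl
  rw [h1, hI, h2, sepConst, h3, ← sqrt_pow_eq_rpow (Nat.cast_nonneg N), smallBallConst,
    Real.sqrt_mul (by norm_num), inv_pow, mul_pow]
  have hp : Real.sqrt Real.pi ≠ 0 := (Real.sqrt_pos.2 Real.pi_pos).ne'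
  have h2' : Real.sqrt 2 ≠ 0 := by positivity
  field_simp
  ring

lemma sepConst_pos {N : ℕ} (hN : N ≠ 0) : 0 < sepConst N := by
  have h : (0 : ℝ) < N := by positivity
  have := Real.Gamma_pos_of_pos (by positivity : (0 : ℝ) < ((N : ℝ) + 1) / 2)
  unfold sepConst
  positivity

/-- A function given by `2E - E²` inherits its diversity and coding gains from the average `E` of
the `Q`-function. -/
lemma hasDiversityCodingGain_of_eq {N : ℕ} (hN : N ≠ 0) {p : ℝ → ℝ}
    (hp : ∀ ρ, 0 < ρ → p ρ = 2 * meanGaussQ N ρ - meanGaussQ N ρ ^ 2) :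
    HasDiversityCodingGain p ((N : ℝ) / 2) (sepConst N ^ (-(2 / (N : ℝ)))) := by
  have hN0 : (0 : ℝ) < N := by positivity
  have hC := sepConst_pos hN
  refine ⟨by positivity, by positivity, ?_⟩
  have hinv : Tendsto (fun ρ : ℝ => (Real.sqrt ρ ^ N)⁻¹) atTop (nhds 0) :=
    tendsto_inv_atTop_zero.comp ((tendsto_pow_atTop hN).comp Real.tendsto_sqrt_atTop)
  have hE := tendsto_meanGaussQ hN
  -- Multiplied by `√ρ ^ N`, the term `E²` is a convergent square times `(√ρ ^ N)⁻¹`, hence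
  -- vanishes.
  have hlim : Tendsto (fun ρ : ℝ => 2 * (Real.sqrt ρ ^ N * meanGaussQ N ρ) -
      (Real.sqrt ρ ^ N * meanGaussQ N ρ) ^ 2 * (Real.sqrt ρ ^ N)⁻¹ - sepConst N) atTop
      (nhds 0) := by
    have := ((hE.const_mul 2).sub ((hE.pow 2).mul hinv)).sub_const (sepConst N)
    simpa [two_mul_meanGaussQLimit] using this
  refine (isLittleO_iff_tendsto' ?_).2 (hlim.congr' ?_)
  · filter_upwards [eventually_gt_atTop 0] with ρ hρ h0
    exact absurd h0 (Real.rpow_pos_of_pos hρ _).ne'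
  · filter_upwards [eventually_gt_atTop 0] with ρ hρ
    have hρ0 : 0 < Real.sqrt ρ := Real.sqrt_pos.2 hρ
    -- The exponents `-2/N` and `-N/2` multiply to `1`, so the coding gain encodes exactly the
    -- leading constant.
    have hG : (sepConst N ^ (-(2 / (N : ℝ))) * ρ) ^ (-((N : ℝ) / 2)) =
        sepConst N * (Real.sqrt ρ ^ N)⁻¹ := by
      rw [Real.mul_rpow (by positivity) hρ.le, ← Real.rpow_mul hC.le, Real.rpow_neg hρ.le,
        sqrt_pow_eq_rpow hρ.le]
      have : -(2 / (N : ℝ)) * -((N : ℝ) / 2) = 1 := by field_simp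
      rw [this, Real.rpow_one]
    rw [hG, hp ρ hρ, Real.rpow_neg hρ.le, ← sqrt_pow_eq_rpow hρ.le]
    field_simp

end QuantizedSIMO

end

theorem proposition1 {Ω : Type*} [MeasurableSpace Ω] (P : Measure Ω) [IsProbabilityMeasure P]
    (Nr : ℕ) (hNr : 1 ≤ Nr) (Q₂ : ℂ → ℂ) (hQ₂ : QuantizedSIMO.IsPhaseQuantizer 2 Q₂)
    (s : Ω → ℂ) (h w : Ω → Fin Nr → ℂ) (hsys : QuantizedSIMO.IsRayleighSIMO P 4 Nr s h w) :
    (iIndepFun (fun (i : Fin Nr) (ω : Ω) => QuantizedSIMO.statZ Q₂ (h ω i)) P ∧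
      ∀ i : Fin Nr,
        HasLaw (fun ω => QuantizedSIMO.statZ Q₂ (h ω i)) QuantizedSIMO.halfNormal P) ∧
    (∀ ρ : ℝ, 0 < ρ →
      QuantizedSIMO.averageSEP P Q₂ Q₂ s h w ρ =
        2 * (∫ ω, QuantizedSIMO.gaussQ (Real.sqrt (ρ * QuantizedSIMO.statU Q₂ (h ω))) ∂P) -
          (∫ ω, QuantizedSIMO.gaussQ (Real.sqrt (ρ * QuantizedSIMO.statU Q₂ (h ω))) ∂P) ^ 2) ∧
    QuantizedSIMO.HasDiversityCodingGain (QuantizedSIMO.averageSEP P Q₂ Q₂ s h w)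
      ((Nr : ℝ) / 2)
      ((1 / (Nat.factorial Nr : ℝ) * (2 : ℝ) ^ Nr * Real.pi ^ (-(((Nr : ℝ) + 1) / 2)) *
          (Nr : ℝ) ^ ((Nr : ℝ) / 2) * Real.Gamma (((Nr : ℝ) + 1) / 2)) ^ (-(2 / (Nr : ℝ)))) := by
  have hN : Nr ≠ 0 := Nat.one_le_iff_ne_zero.1 hNr
  have hsep (ρ : ℝ) (hρ : 0 < ρ) := QuantizedSIMO.averageSEP_eq P hN hQ₂ hsys hρ
  refine ⟨⟨QuantizedSIMO.iIndepFun_statZ hsys.channel_law hQ₂,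
    QuantizedSIMO.hasLaw_statZ_comp hsys.channel_law hQ₂⟩, fun ρ hρ => ?_,
    QuantizedSIMO.hasDiversityCodingGain_of_eq hN hsep⟩
  rw [QuantizedSIMO.integral_gaussQ_statU hsys.channel_law hQ₂ hρ, hsep ρ hρ]
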